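/- Definitions. A graph is a finite connected multigraph $G$ without loop edges, with vertex set $V$ and edge set $E$ (a single vertex without edges is allowed). A length function $\ell\colon E\to\mathbb R_{>0}$ determines a metric graph $\Gamma=\Gamma_{\ell}$, obtained by gluing segments $[0,\ell(e)]$, $e\in E$, according to $G$; every metric graph arises in this way, and $(G,\ell)$ is called a model of it. The genus of $\Gamma$ is $|E|-|V|+1$. A $\mathbb Q$-graph is a metric graph having a model whose edge lengths are all rational. $\operatorname{Div}(\Gamma)$ is the free abelian group on the points of $\Gamma$, with the usual degree and the usual notion of effective divisor. A rational function on $\Gamma$ is a continuous, piecewise affine function $f\colon\Gamma\to\mathbb R$ with integer slopes, and its divisor is $(f)=-\sum_{P}\sigma_P(f)(P)$, where $\sigma_P(f)$ is the sum of the slopes of $f$ in all directions emanating from $P$. Write $D\sim F$ if $D-F=(f)$ for some rational function $f$, and $|D|=\{F\ge 0: F\sim D\}$. Put $r_\Gamma(D)=-1$ if $|D|=\emptyset$, and otherwise let $r_\Gamma(D)$ be the largest $k\in\mathbb Z$ such that $|D-F|\neq\emptyset$ for all effective divisors $F$ of degree $k$. We say that $\Gamma$ has a $g^r_{\le d}$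 if there is a divisor $D$ on $\Gamma$ with $\deg D\le d$ and $r_\Gamma(D)=r$. Fix a metric graph $\Gamma$ with model $(G,\ell)$ and a real number $\epsilon>0$ smaller than all edge lengths $\ell(e)$. Let $A_\epsilon(\Gamma)\subset\mathbb R^{E}$ be the compact box of all $\ell'$ with $|\ell'(e)-\ell(e)|\le\epsilon$ for all $e\in E$; its points are identified with the metric graphs $\Gamma'=\Gamma_{\ell'}$ of the same combinatorial type as $\Gamma$. For an integer $d\ge 0$ let $M=M^d_\epsilon(\Gamma)$ be the set of pairs $(\Gamma',D')$ with $\Gamma'\in A_\epsilon(\Gamma)$ and $D'$ an effective divisor of degree $d$ on $\Gamma'$. For each $c\colon\{1,\dots,d\}\to E$ there is a compact polyhedron $\{(\ell',t): \ell'\in A_\epsilon(\Gamma),\ 0\le t_i\le\ell'(c(i)) \text{ for all } i\}$, which maps to $M$ by sending $(\ell',t)$ to $(\Gamma_{\ell'},P_1+\dots+P_d)$, where $P_i$ is the point with parameter $t_i$ on the edge $c(i)$. Give $M$ the topology obtained by gluing these polyhedra, i.e. the finest topology for which all these maps are continuous (if $E=\emptyset$, then $M$ is a point). Lemma (Semicontinuity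 Lemma). (1) For every metric graph $\Gamma$ with model $(G,\ell)$, every $\epsilon$ as above and every integer $d\ge 0$, the space $M^d_\epsilon(\Gamma)$ is compact and the function $M^d_\epsilon(\Gamma)\to\mathbb Z$, $(\Gamma',D')\mapsto r_{\Gamma'}(D')$, is upper semicontinuous, i.e. the set $\{(\Gamma',D'): r_{\Gamma'}(D')\ge i\}$ is closed for every $i\in\mathbb Z$. (2) For all $\Gamma$, $(G,\ell)$ and $\epsilon$ as above and all integers $r,d$, the set of all $\Gamma'\in A_\epsilon(\Gamma)$ that have a $g^r_{\le d}$ is closed in $A_\epsilon(\Gamma)$. In particular, if $\Gamma_n$ is a sequence in $A_\epsilon(\Gamma)$ converging to $\Gamma$ and every $\Gamma_n$ has a $g^r_{\le d}$, then $\Gamma$ has a $g^r_{\le d}$. (3) For all integers $g,r,d$: if every $\mathbb Q$-graph of genus $g$ has a $g^r_{\le d}$, then every metric graph of genus $g$ has a $g^r_{\le d}$. -/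

import Mathlib

universe u v

/-- A graph: a finite (finiteness is put on `V` and `E` where it is used), connected multigraph
without loop edges, with vertex type `V` and edge type `E`.  Each edge carries an orientation from
`src e` to `tgt e`, chosen only in order to parametrize the edge by an interval. -/
structure FinGraph (V : Type u) (E : Type v) where
  src : E → V
  tgt : E → V
  loopless : ∀ e, src e ≠ tgt e
  connected : (SimpleGraph.fromRel fun v w => ∃ e, src e = v ∧ tgt e = w).Connected

namespace FinGraph

variable {V : Type u} {E : Type v}

/-- The genus (cyclomatic number) `|E| - |V| + 1`. -/
def genus [Fintype V] [Fintype E] (_G : FinGraph V E) : ℤ :=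
  (Fintype.card E : ℤ) - (Fintype.card V : ℤ) + 1

/-- The points of the metric graph `Γ` with model `(G, ℓ)`: the vertices, and for each edge `e`
the points of the open segment `(0, ℓ e)`. -/
inductive Point (G : FinGraph V E) (ℓ : E → ℝ) : Type (max u v)
  | vertex (v : V) : Point G ℓ
  | inner (e : E) (t : ℝ) (pos : 0 < t) (lt : t < ℓ e) : Point G ℓ

/-- The parametrization `[0, ℓ e] → Γ` of the edge `e`; it is extended to all of `ℝ`
by the constant values `src e` on the left and `tgt e` on the right. -/
noncomputable def edgeMap (G : FinGraph V E) (ℓ : E → ℝ) (e : E) (t : ℝ) : G.Point ℓ :=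
  if h₀ : t ≤ 0 then Point.vertex (G.src e)
  else if h₁ : ℓ e ≤ t then Point.vertex (G.tgt e)
  else Point.inner e t (not_le.mp h₀) (not_le.mp h₁)

/-- The topology of `Γ`: that of the segments `[0, ℓ e]` glued at their ends, i.e. the finest
topology for which every edge `[0, ℓ e] → Γ` is continuous.  (If there is no edge, then `Γ` is a
single point.) -/
noncomputable instance (G : FinGraph V E) (ℓ : E → ℝ) : TopologicalSpace (G.Point ℓ) :=
  ⨆ e : E, TopologicalSpace.coinduced
    (fun t : Set.Icc (0 : ℝ) (ℓ e) => G.edgeMap ℓ e t) inferInstance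

/-- A rational function on `Γ`: continuous and, on every edge, affine with integer slope away
from finitely many points. -/
structure IsRational (G : FinGraph V E) (ℓ : E → ℝ) (f : G.Point ℓ → ℝ) : Prop where
  continuous : Continuous f
  piecewise_affine : ∀ e : E, ∃ S : Finset ℝ, ∀ a b : ℝ, 0 ≤ a → a < b → b ≤ ℓ e →
    (∀ t ∈ Set.Ioo a b, t ∉ S) →
    ∃ (m : ℤ) (c : ℝ), ∀ t ∈ Set.Ioo a b, f (G.edgeMap ℓ e t) = m * t + c

/-- The slope of `f` at the point at parameter `t` of the edge `e`, in the direction of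
increasing parameter. -/
noncomputable def forwardSlope (G : FinGraph V E) (ℓ : E → ℝ) (f : G.Point ℓ → ℝ)
    (e : E) (t : ℝ) : ℝ :=
  derivWithin (fun s => f (G.edgeMap ℓ e s)) (Set.Ici t) t

/-- The slope of `f` at the point at parameter `t` of the edge `e`, in the direction of
decreasing parameter. -/
noncomputable def backwardSlope (G : FinGraph V E) (ℓ : E → ℝ) (f : G.Point ℓ → ℝ)
    (e : E) (t : ℝ) : ℝ :=
  - derivWithin (fun s => f (G.edgeMap ℓ e s)) (Set.Iic t) t

open Classical in
/-- `σ_P(f)`: the sum of the slopes of `f` in all directions emanating from `P`. -/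
noncomputable def slopeSum [Fintype E] (G : FinGraph V E) (ℓ : E → ℝ) (f : G.Point ℓ → ℝ) :
    G.Point ℓ → ℝ
  | Point.vertex v =>
      (∑ e : E, if G.src e = v then G.forwardSlope ℓ f e 0 else 0) +
        ∑ e : E, if G.tgt e = v then G.backwardSlope ℓ f e (ℓ e) else 0
  | Point.inner e t _ _ => G.forwardSlope ℓ f e t + G.backwardSlope ℓ f e t

/-- Divisors on `Γ`: the free abelian group on its points. -/
abbrev Divisor (G : FinGraph V E) (ℓ : E → ℝ) : Type (max u v) := G.Point ℓ →₀ ℤ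

/-- The degree of a divisor. -/
noncomputable def deg {G : FinGraph V E} {ℓ : E → ℝ} (D : G.Divisor ℓ) : ℤ :=
  D.sum fun _ a => a

/-- `D` is principal: `D = (f) = -∑_P σ_P(f) (P)` for a rational function `f`. -/
def IsPrincipal [Fintype E] {G : FinGraph V E} {ℓ : E → ℝ} (D : G.Divisor ℓ) : Prop :=
  ∃ f : G.Point ℓ → ℝ, G.IsRational ℓ f ∧ ∀ P, (D P : ℝ) = - G.slopeSum ℓ f P

/-- The complete linear system `|D|`: all effective divisors linearly equivalent to `D`. -/
def linearSystem [Fintype E] {G : FinGraph V E} {ℓ : E → ℝ} (D : G.Divisor ℓ) :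
    Set (G.Divisor ℓ) :=
  {F | 0 ≤ F ∧ IsPrincipal (F - D)}

open Classical in
/-- The rank `r_Γ(D)`: it is `-1` if `|D| = ∅`, and otherwise the largest integer `k` such that
`|D - F| ≠ ∅` for all effective divisors `F` of degree `k`. -/
noncomputable def rank [Fintype E] {G : FinGraph V E} {ℓ : E → ℝ} (D : G.Divisor ℓ) : ℤ :=
  if (linearSystem D).Nonempty then
    sSup {k : ℤ | ∀ F : G.Divisor ℓ, 0 ≤ F → deg F = k → (linearSystem (D - F)).Nonempty}
  else -1

/-- The metric graph with model `(G, ℓ)` has a `g^r_{≤ d}`. -/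
def HasLinearSystem [Fintype E] (G : FinGraph V E) (ℓ : E → ℝ) (r d : ℤ) : Prop :=
  ∃ D : G.Divisor ℓ, deg D ≤ d ∧ rank D = r

/-- `A_ε(Γ)`: the metric graphs of the same combinatorial type as `Γ`, given by their edge lengths,
which are within `ε` of those of `Γ`; a compact box in `ℝ^E`. -/
abbrev LengthBox (ℓ : E → ℝ) (ε : ℝ) : Type v := {ℓ' : E → ℝ // ∀ e, |ℓ' e - ℓ e| ≤ ε}

/-- The underlying set of `M = M^d_ε(Γ)`: pairs `(Γ', D')` with `Γ'` in `A_ε(Γ)` and `D'` an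
effective divisor of degree `d` on `Γ'`. -/
structure DivisorSpace (G : FinGraph V E) (ℓ : E → ℝ) (ε : ℝ) (d : ℕ) : Type (max u v) where
  len : LengthBox ℓ ε
  div : G.Divisor len.1
  effective : 0 ≤ div
  deg_eq : deg div = d

/-- The closed polyhedral cell of `M` in which the `i`-th point of the divisor lies on the edge
`c i`, in the coordinates given by the edge lengths and the parameters of the `d` points. -/
abbrev Cell (ℓ : E → ℝ) (ε : ℝ) {d : ℕ} (c : Fin d → E) : Type v :=
  {p : LengthBox ℓ ε × (Fin d → ℝ) // ∀ i, 0 ≤ p.2 i ∧ p.2 i ≤ p.1.1 (c i)}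

theorem deg_sum_single {G : FinGraph V E} {ℓ : E → ℝ} {d : ℕ} (P : Fin d → G.Point ℓ) :
    deg (∑ i, Finsupp.single (P i) (1 : ℤ)) = d := by
  have h : ∀ s : Finset (Fin d),
      deg (∑ i ∈ s, Finsupp.single (P i) (1 : ℤ)) = ∑ _i ∈ s, (1 : ℤ) := by
    intro s
    unfold deg
    rw [← Finsupp.sum_finsetSum_index (fun _ => rfl) (fun _ _ _ => rfl)]
    simp
  simpa using h Finset.univ

/-- The map from a cell to `M`, sending `(ℓ', t)` to the metric graph with edge lengths `ℓ'` and
the sum of the points at parameter `t i` of the edge `c i`. -/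
noncomputable def cellMap (G : FinGraph V E) (ℓ : E → ℝ) (ε : ℝ) {d : ℕ} (c : Fin d → E)
    (p : Cell ℓ ε c) : G.DivisorSpace ℓ ε d where
  len := p.1.1
  div := ∑ i, Finsupp.single (G.edgeMap p.1.1.1 (c i) (p.1.2 i)) 1
  effective := Finset.sum_nonneg fun i _ => by simp
  deg_eq := deg_sum_single _

/-- The topology of the polyhedral complex `M`: that of its closed polyhedral cells glued
together, i.e. the finest topology for which all cell maps are continuous.  (If there is no edge,
then `M` is a single point.) -/
noncomputable instance (G : FinGraph V E) (ℓ : E → ℝ) (ε : ℝ) (d : ℕ) :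
    TopologicalSpace (G.DivisorSpace ℓ ε d) :=
  ⨆ c : Fin d → E, TopologicalSpace.coinduced (G.cellMap ℓ ε c) inferInstance

end FinGraph

namespace FinGraph

open Set Filter Topology

open scoped Classical

/-! ### One-sided slopes and rational functions on a single edge. -/

section

/-- `h` is affine with slope `m` to the right of `t`. -/
def RightAffine (h : ℝ → ℝ) (t m : ℝ) : Prop :=
  ∀ᶠ s in 𝓝[≥] t, h s = h t + m * (s - t)

/-- `h` is affine with slope `m` to the left of `t`. -/
def LeftAffine (h : ℝ → ℝ) (t m : ℝ) : Prop :=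
  ∀ᶠ s in 𝓝[≤] t, h s = h t + m * (s - t)

theorem hasDerivAt_affine (a m t : ℝ) : HasDerivAt (fun s => a + m * (s - t)) m t := by
  simpa using (((hasDerivAt_id t).sub_const t).const_mul m).const_add a

theorem RightAffine.derivWithin_eq {h : ℝ → ℝ} {t m : ℝ} (H : RightAffine h t m) :
    derivWithin h (Ici t) t = m :=
  ((hasDerivAt_affine (h t) m t).hasDerivWithinAt.congr_of_eventuallyEq H
    (by simp)).derivWithin (uniqueDiffOn_Ici t t self_mem_Ici)

theorem LeftAffine.derivWithin_eq {h : ℝ → ℝ} {t m : ℝ} (H : LeftAffine h t m) :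
    derivWithin h (Iic t) t = m :=
  ((hasDerivAt_affine (h t) m t).hasDerivWithinAt.congr_of_eventuallyEq H
    (by simp)).derivWithin (uniqueDiffOn_Iic t t self_mem_Iic)

theorem RightAffine.add {h k : ℝ → ℝ} {t m n : ℝ} (H : RightAffine h t m)
    (K : RightAffine k t n) : RightAffine (fun s => h s + k s) t (m + n) := by
  filter_upwards [H, K] with s h1 h2
  rw [h1, h2]; ring

theorem LeftAffine.add {h k : ℝ → ℝ} {t m n : ℝ} (H : LeftAffine h t m)
    (K : LeftAffine k t n) : LeftAffine (fun s => h s + k s) t (m + n) := by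
  filter_upwards [H, K] with s h1 h2
  rw [h1, h2]; ring

theorem RightAffine.neg {h : ℝ → ℝ} {t m : ℝ} (H : RightAffine h t m) :
    RightAffine (fun s => - h s) t (-m) := by
  filter_upwards [H] with s h1
  rw [h1]; ring

theorem LeftAffine.neg {h : ℝ → ℝ} {t m : ℝ} (H : LeftAffine h t m) :
    LeftAffine (fun s => - h s) t (-m) := by
  filter_upwards [H] with s h1
  rw [h1]; ring

theorem rightAffine_affine (a m t : ℝ) : RightAffine (fun s => a + m * s) t m :=
  Eventually.of_forall fun s => by ring

theorem leftAffine_affine (a m t : ℝ) : LeftAffine (fun s => a + m * s) t m :=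
  Eventually.of_forall fun s => by ring

/-- A kink at `a` counts here when `a ≤ t`, but in `leftAffine_max` only when `a < t`. The
difference of the two slopes at `t` is exactly the chip at `t`. -/
theorem rightAffine_max (a t : ℝ) :
    RightAffine (fun s => max 0 (s - a)) t (if a ≤ t then 1 else 0) := by
  split_ifs with h
  · filter_upwards [self_mem_nhdsWithin] with s (hs : t ≤ s)
    rw [max_eq_right (by linarith), max_eq_right (by linarith)]; ring
  · have : Iio a ∈ 𝓝[≥] t := mem_nhdsWithin_of_mem_nhds (Iio_mem_nhds (not_le.mp h))
    filter_upwards [this] with s (hs : s < a)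
    rw [max_eq_left (by linarith), max_eq_left (by linarith)]; ring

theorem leftAffine_max (a t : ℝ) :
    LeftAffine (fun s => max 0 (s - a)) t (if a < t then 1 else 0) := by
  split_ifs with h
  · have : Ioi a ∈ 𝓝[≤] t := mem_nhdsWithin_of_mem_nhds (Ioi_mem_nhds h)
    filter_upwards [this] with s (hs : a < s)
    rw [max_eq_right (by linarith), max_eq_right (by linarith)]; ring
  · filter_upwards [self_mem_nhdsWithin] with s (hs : s ≤ t)
    rw [max_eq_left (by linarith), max_eq_left (by linarith)]; ring

theorem RightAffine.sum {J : Type*} [Fintype J] {h : J → ℝ → ℝ} {t : ℝ} {m : J → ℝ}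
    (H : ∀ j, RightAffine (h j) t (m j)) :
    RightAffine (fun s => ∑ j, h j s) t (∑ j, m j) := by
  filter_upwards [eventually_all.2 H] with s hs
  rw [Finset.sum_mul, ← Finset.sum_add_distrib]
  exact Finset.sum_congr rfl fun j _ => hs j

theorem LeftAffine.sum {J : Type*} [Fintype J] {h : J → ℝ → ℝ} {t : ℝ} {m : J → ℝ}
    (H : ∀ j, LeftAffine (h j) t (m j)) :
    LeftAffine (fun s => ∑ j, h j s) t (∑ j, m j) := by
  filter_upwards [eventually_all.2 H] with s hs
  rw [Finset.sum_mul, ← Finset.sum_add_distrib]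
  exact Finset.sum_congr rfl fun j _ => hs j

theorem RightAffine.const_mul {h : ℝ → ℝ} {t m : ℝ} (H : RightAffine h t m) (a : ℝ) :
    RightAffine (fun s => a * h s) t (a * m) := by
  filter_upwards [H] with s h1
  rw [h1]; ring

theorem LeftAffine.const_mul {h : ℝ → ℝ} {t m : ℝ} (H : LeftAffine h t m) (a : ℝ) :
    LeftAffine (fun s => a * h s) t (a * m) := by
  filter_upwards [H] with s h1
  rw [h1]; ring

theorem RightAffine.congr {h k : ℝ → ℝ} {t b m : ℝ} (H : RightAffine h t m) (htb : t < b)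
    (hk : ∀ s ∈ Ico t b, k s = h s) : RightAffine k t m := by
  filter_upwards [H, Ico_mem_nhdsGE htb] with s h1 h2
  rw [hk s h2, hk t ⟨le_rfl, htb⟩, h1]

theorem LeftAffine.congr {h k : ℝ → ℝ} {t b m : ℝ} (H : LeftAffine h t m) (htb : b < t)
    (hk : ∀ s ∈ Ioc b t, k s = h s) : LeftAffine k t m := by
  filter_upwards [H, Ioc_mem_nhdsLE htb] with s h1 h2
  rw [hk s h2, hk t ⟨htb, le_rfl⟩, h1]

/-- A function that is locally affine with integer slopes in the interior of an interval is
globally affine. -/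
theorem exists_affine_of_locally_affine {k : ℝ → ℝ} {L : ℝ} (hL : 0 < L)
    (hc : ContinuousOn k (Icc 0 L))
    (hk : ∀ t ∈ Ioo 0 L, ∃ m : ℤ, RightAffine k t m ∧ LeftAffine k t m) :
    ∃ m : ℤ, ∀ t ∈ Icc 0 L, k t = k 0 + m * t := by
  have hloc : ∀ t ∈ Ioo 0 L, ∃ m : ℤ, ∀ᶠ s in 𝓝 t, k s = k t + m * (s - t) := by
    intro t ht
    obtain ⟨m, h1, h2⟩ := hk t ht
    refine ⟨m, ?_⟩
    rw [← nhdsLE_sup_nhdsGE]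
    exact eventually_sup.2 ⟨h2, h1⟩
  have hderiv : ∀ t ∈ Ioo 0 L, ∃ m : ℤ, HasDerivAt k m t ∧ ∀ᶠ s in 𝓝 t, deriv k s = m := by
    intro t ht
    obtain ⟨m, hm⟩ := hloc t ht
    refine ⟨m, (hasDerivAt_affine (k t) m t).congr_of_eventuallyEq hm, ?_⟩
    filter_upwards [hm.eventually_nhds] with s hs
    have : HasDerivAt (fun x => k t + m * (x - t)) (m : ℝ) s := by
      simpa using (((hasDerivAt_id s).sub_const t).const_mul (m : ℝ)).const_add (k t)
    exact (this.congr_of_eventuallyEq hs).deriv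
  have hmid : L / 2 ∈ Ioo 0 L := ⟨by linarith, by linarith⟩
  obtain ⟨m, hm, -⟩ := hderiv _ hmid
  -- The derivative is locally constant on a connected interval, hence constant. Continuity then
  -- carries the affine formula to both ends.
  have hconst : ∀ t ∈ Ioo 0 L, deriv k t = m := by
    intro t ht
    rw [← hm.deriv]
    refine isOpen_Ioo.is_const_of_deriv_eq_zero isPreconnected_Ioo ?_ ?_ ht hmid
    · intro s hs
      obtain ⟨n, -, hn⟩ := hderiv s hs
      exact ((hasDerivAt_const s (n : ℝ)).congr_of_eventuallyEq
        hn).differentiableAt.differentiableWithinAt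
    · intro s hs
      obtain ⟨n, -, hn⟩ := hderiv s hs
      exact ((hasDerivAt_const s (n : ℝ)).congr_of_eventuallyEq hn).deriv
  have hsub : ∀ t ∈ Ioo 0 L, HasDerivAt (fun s => k s - m * s) 0 t := by
    intro t ht
    obtain ⟨n, hn, -⟩ := hderiv t ht
    have h1 : (n : ℝ) = m := by rw [← hconst t ht, hn.deriv]
    rw [h1] at hn
    have := hn.sub ((hasDerivAt_id t).const_mul (m : ℝ))
    rw [mul_one, sub_self] at this
    exact this
  refine ⟨m, fun t ht => ?_⟩
  have hc' : ContinuousOn (fun s => k s - m * s) (Icc 0 L) := hc.sub (by fun_prop)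
  have key : ∀ t ∈ Ioo 0 L, k t - m * t = k (L / 2) - m * (L / 2) := fun t ht =>
    isOpen_Ioo.is_const_of_deriv_eq_zero isPreconnected_Ioo
      (fun s hs => (hsub s hs).differentiableAt.differentiableWithinAt)
      (fun s hs => (hsub s hs).deriv) ht hmid
  have key2 : ∀ t ∈ Icc 0 L, k t - m * t = k (L / 2) - m * (L / 2) := by
    have : EqOn (fun s => k s - m * s) (fun _ => k (L / 2) - m * (L / 2)) (Icc 0 L) :=
      EqOn.of_subset_closure (s := Ioo 0 L) (fun s hs => key s hs) hc' continuousOn_const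
        Ioo_subset_Icc_self (by rw [closure_Ioo hL.ne])
    exact fun t ht => this ht
  have h1 := key2 t ht
  have h2 := key2 0 ⟨le_rfl, hL.le⟩
  linarith

variable {V : Type*} {E : Type*} {G : FinGraph V E} {ℓ : E → ℝ}

theorem continuousOn_comp_edgeMap {f : G.Point ℓ → ℝ} (hf : Continuous f) (e : E) :
    ContinuousOn (fun t => f (G.edgeMap ℓ e t)) (Icc 0 (ℓ e)) := by
  rw [continuousOn_iff_continuous_domRestrict]
  have h := continuous_iSup_dom.1 hf e
  exact continuous_coinduced_dom.1 h

theorem continuous_of_comp_edgeMap {f : G.Point ℓ → ℝ}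
    (hf : ∀ e, ContinuousOn (fun t => f (G.edgeMap ℓ e t)) (Icc 0 (ℓ e))) : Continuous f :=
  continuous_iSup_dom.2 fun e =>
    continuous_coinduced_dom.2 (continuousOn_iff_continuous_domRestrict.1 (hf e))

/-- Some interval to the right of `t` contains no break point, so `f` is affine there; continuity
extends the formula to `t` itself, which may be a break point. -/
theorem IsRational.rightAffine {f : G.Point ℓ → ℝ} (hf : G.IsRational ℓ f) {e : E} {t : ℝ}
    (h0 : 0 ≤ t) (h1 : t < ℓ e) :
    ∃ m : ℤ, RightAffine (fun s => f (G.edgeMap ℓ e s)) t m := by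
  obtain ⟨S, hS⟩ := hf.piecewise_affine e
  have hev : ∀ᶠ s in 𝓝[>] t, s ∈ ((S.erase t : Finset ℝ) : Set ℝ)ᶜ ∩ Iio (ℓ e) := by
    refine mem_nhdsWithin_of_mem_nhds (inter_mem ?_ (Iio_mem_nhds h1))
    exact (Finset.isClosed _).isOpen_compl.mem_nhds (by simp)
  obtain ⟨b, htb, hb⟩ := mem_nhdsGT_iff_exists_Ioo_subset.1 hev
  have htb : t < b := htb
  obtain ⟨m, c, hmc⟩ := hS t (min b (ℓ e)) h0 (lt_min htb h1) (min_le_right _ _) (by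
    intro s hs hsS
    have := (hb ⟨hs.1, hs.2.trans_le (min_le_left _ _)⟩).1
    simp only [Finset.coe_erase, mem_compl_iff, Set.mem_sdiff, not_and, not_not] at this
    exact hs.1.ne' (this hsS))
  have hcont : EqOn (fun s => f (G.edgeMap ℓ e s)) (fun s => m * s + c)
      (Ico t (min b (ℓ e))) := by
    refine EqOn.of_subset_closure (s := Ioo t (min b (ℓ e))) (fun s hs => hmc s hs)
      ((continuousOn_comp_edgeMap hf.continuous e).mono fun s hs =>
        ⟨h0.trans hs.1, hs.2.le.trans (min_le_right _ _)⟩) (by fun_prop)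
      Ioo_subset_Ico_self ?_
    rw [closure_Ioo (lt_min htb h1).ne]; exact Ico_subset_Icc_self
  refine ⟨m, (rightAffine_affine c m t).congr (lt_min htb h1) fun s hs => ?_⟩
  rw [add_comm]; exact hcont hs

theorem IsRational.leftAffine {f : G.Point ℓ → ℝ} (hf : G.IsRational ℓ f) {e : E} {t : ℝ}
    (h0 : 0 < t) (h1 : t ≤ ℓ e) :
    ∃ m : ℤ, LeftAffine (fun s => f (G.edgeMap ℓ e s)) t m := by
  obtain ⟨S, hS⟩ := hf.piecewise_affine e
  have hev : ∀ᶠ s in 𝓝[<] t, s ∈ ((S.erase t : Finset ℝ) : Set ℝ)ᶜ ∩ Ioi 0 := by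
    refine mem_nhdsWithin_of_mem_nhds (inter_mem ?_ (Ioi_mem_nhds h0))
    exact (Finset.isClosed _).isOpen_compl.mem_nhds (by simp)
  obtain ⟨b, htb, hb⟩ := mem_nhdsLT_iff_exists_Ioo_subset.1 hev
  have htb : b < t := htb
  obtain ⟨m, c, hmc⟩ := hS (max b 0) t (le_max_right _ _) (max_lt htb h0) h1 (by
    intro s hs hsS
    have := (hb ⟨(le_max_left _ _).trans_lt hs.1, hs.2⟩).1
    simp only [Finset.coe_erase, mem_compl_iff, Set.mem_sdiff, not_and, not_not] at this
    exact hs.2.ne (this hsS))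
  have hcont : EqOn (fun s => f (G.edgeMap ℓ e s)) (fun s => m * s + c)
      (Ioc (max b 0) t) := by
    refine EqOn.of_subset_closure (s := Ioo (max b 0) t) (fun s hs => hmc s hs)
      ((continuousOn_comp_edgeMap hf.continuous e).mono fun s hs =>
        ⟨(le_max_right _ _).trans hs.1.le, hs.2.trans h1⟩) (by fun_prop)
      Ioo_subset_Ioc_self ?_
    rw [closure_Ioo (max_lt htb h0).ne]; exact Ioc_subset_Icc_self
  refine ⟨m, (leftAffine_affine c m t).congr (max_lt htb h0) fun s hs => ?_⟩
  rw [add_comm]; exact hcont hs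

theorem edgeMap_eq_inner_iff {e e' : E} {t t' : ℝ} {h0 : 0 < t'} {h1 : t' < ℓ e'} :
    G.edgeMap ℓ e t = Point.inner e' t' h0 h1 ↔ e = e' ∧ t = t' := by
  unfold edgeMap
  split_ifs with ha hb
  · simp only [false_iff]; rintro ⟨rfl, rfl⟩; linarith
  · simp only [false_iff]; rintro ⟨rfl, rfl⟩; linarith
  · simp

theorem edgeMap_eq_vertex_iff {e : E} {t : ℝ} (h0 : 0 ≤ t) (h1 : t ≤ ℓ e) (hℓ : 0 < ℓ e) {v : V} :
    G.edgeMap ℓ e t = Point.vertex v ↔ (G.src e = v ∧ t = 0) ∨ (G.tgt e = v ∧ t = ℓ e) := by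
  unfold edgeMap
  split_ifs with ha hb
  · obtain rfl : t = 0 := le_antisymm ha h0
    simp [hℓ.ne]
  · obtain rfl : t = ℓ e := le_antisymm h1 hb
    simp [hℓ.ne']
  · simp only [false_iff]
    rintro (⟨-, h⟩ | ⟨-, h⟩)
    · exact ha h.le
    · exact hb h.ge

theorem edgeMap_zero (e : E) : G.edgeMap ℓ e 0 = Point.vertex (G.src e) := by simp [edgeMap]

theorem edgeMap_length {e : E} (h : 0 < ℓ e) :
    G.edgeMap ℓ e (ℓ e) = Point.vertex (G.tgt e) := by simp [edgeMap, not_le.2 h]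

theorem edgeMap_of_mem_Ioo {e : E} {t : ℝ} (h0 : 0 < t) (h1 : t < ℓ e) :
    G.edgeMap ℓ e t = Point.inner e t h0 h1 := edgeMap_eq_inner_iff.2 ⟨rfl, rfl⟩

end

/-! ### Principal divisors as solutions of equations for slopes and vertex values. -/

section

variable {V : Type*} {E : Type*} {J : Type*} [Fintype J]

/-- The contribution to a rational function on the edge `e` of chips `σ j` placed at parameter
`t j` on the edge `c j`. -/
noncomputable def bend (c : J → E) (t : J → ℝ) (σ : J → ℤ) (e : E) (s : ℝ) : ℝ :=
  ∑ j, if c j = e then (σ j : ℝ) * max 0 (s - t j) else 0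

theorem continuous_bend (c : J → E) (t : J → ℝ) (σ : J → ℤ) (e : E) :
    Continuous (bend c t σ e) := by
  refine continuous_finsetSum _ fun j _ => ?_
  split_ifs <;> fun_prop

theorem rightAffine_bend (c : J → E) (t : J → ℝ) (σ : J → ℤ) (e : E) (s : ℝ) :
    RightAffine (bend c t σ e) s (∑ j, if c j = e ∧ t j ≤ s then (σ j : ℝ) else 0) := by
  refine RightAffine.sum fun j => ?_
  by_cases h : c j = e
  · simpa [h] using (rightAffine_max (t j) s).const_mul (σ j)
  · simpa [h] using rightAffine_affine 0 0 s

theorem leftAffine_bend (c : J → E) (t : J → ℝ) (σ : J → ℤ) (e : E) (s : ℝ) :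
    LeftAffine (bend c t σ e) s (∑ j, if c j = e ∧ t j < s then (σ j : ℝ) else 0) := by
  refine LeftAffine.sum fun j => ?_
  by_cases h : c j = e
  · simpa [h] using (leftAffine_max (t j) s).const_mul (σ j)
  · simpa [h] using leftAffine_affine 0 0 s

theorem bend_zero {c : J → E} {t : J → ℝ} (ht : ∀ j, 0 ≤ t j) (σ : J → ℤ) (e : E) :
    bend c t σ e 0 = 0 := by
  refine Finset.sum_eq_zero fun j _ => ?_
  rw [max_eq_left (by linarith [ht j])]; simp

theorem bend_length {c : J → E} {t : J → ℝ} {ℓ : E → ℝ} (ht : ∀ j, t j ≤ ℓ (c j)) (σ : J → ℤ)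
    (e : E) : bend c t σ e (ℓ e) = ∑ j, if c j = e then (σ j : ℝ) * (ℓ e - t j) else 0 := by
  refine Finset.sum_congr rfl fun j _ => ?_
  split_ifs with h
  · subst h; rw [max_eq_right (by linarith [ht j])]
  · rfl

/-- The divisor with chips `σ j` at parameter `t j` on the edge `c j`. -/
noncomputable def chipDivisor (G : FinGraph V E) (ℓ : E → ℝ) (c : J → E) (t : J → ℝ) (σ : J → ℤ) :
    G.Divisor ℓ :=
  ∑ j, Finsupp.single (G.edgeMap ℓ (c j) (t j)) (σ j)

variable {G : FinGraph V E} {ℓ : E → ℝ} {c : J → E} {t : J → ℝ} {σ : J → ℤ}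

theorem chipDivisor_apply (P : G.Point ℓ) :
    (G.chipDivisor ℓ c t σ P : ℝ) =
      ∑ j, if G.edgeMap ℓ (c j) (t j) = P then (σ j : ℝ) else 0 := by
  simp [chipDivisor, Finsupp.finsetSum_apply, Finsupp.single_apply]

theorem chipDivisor_inner {e : E} {s : ℝ} (h0 : 0 < s) (h1 : s < ℓ e) :
    (G.chipDivisor ℓ c t σ (Point.inner e s h0 h1) : ℝ) =
      (∑ j, if c j = e ∧ t j ≤ s then (σ j : ℝ) else 0) -
        ∑ j, if c j = e ∧ t j < s then (σ j : ℝ) else 0 := by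
  rw [chipDivisor_apply, ← Finset.sum_sub_distrib]
  refine Finset.sum_congr rfl fun j _ => ?_
  rw [edgeMap_eq_inner_iff]
  by_cases h : c j = e
  · rcases lt_trichotomy (t j) s with h' | h' | h'
    · simp [h, h', h'.le, h'.ne]
    · simp [h, h']
    · simp [h, h'.not_ge, h'.not_gt, h'.ne']
  · simp [h]

/-- The sums are those that occur in the one-sided slopes: the slope at the origin of an edge
already includes chips placed there, while the slope at its end includes only chips strictly before
the end. -/
theorem chipDivisor_vertex (hℓ : ∀ e, 0 < ℓ e) (ht : ∀ j, 0 ≤ t j ∧ t j ≤ ℓ (c j)) (v : V) :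
    (G.chipDivisor ℓ c t σ (Point.vertex v) : ℝ) =
      (∑ j, if G.src (c j) = v ∧ t j ≤ 0 then (σ j : ℝ) else 0) +
        ((∑ j, if G.tgt (c j) = v then (σ j : ℝ) else 0) -
        ∑ j, if G.tgt (c j) = v ∧ t j < ℓ (c j) then (σ j : ℝ) else 0) := by
  rw [chipDivisor_apply, ← Finset.sum_sub_distrib, ← Finset.sum_add_distrib]
  refine Finset.sum_congr rfl fun j _ => ?_
  obtain ⟨h0, h1⟩ := ht j
  rw [edgeMap_eq_vertex_iff h0 h1 (hℓ _)]
  rcases h0.eq_or_lt with h | h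
  · have := hℓ (c j)
    simp [← h, this, this.ne]
  · rcases h1.eq_or_lt with h' | h'
    · have := hℓ (c j)
      simp [h', this, this.ne']
    · simp [h.ne', h.not_ge, h', h'.ne]

theorem sum_fiber [Fintype E] (c : J → E) (p : E → Prop) (q : E → J → Prop) (a : J → ℝ) :
    (∑ e, if p e then ∑ j, (if c j = e ∧ q e j then a j else 0) else 0) =
      ∑ j, if p (c j) ∧ q (c j) j then a j else 0 := by
  have : ∀ e, (if p e then ∑ j, (if c j = e ∧ q e j then a j else 0) else 0) =
      ∑ j, if c j = e then (if p (c j) ∧ q (c j) j then a j else 0) else 0 := by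
    intro e
    split_ifs with h
    · refine Finset.sum_congr rfl fun j _ => ?_
      by_cases hj : c j = e
      · subst hj; simp [h]
      · simp [hj]
    · symm
      refine Finset.sum_eq_zero fun j _ => ?_
      by_cases hj : c j = e
      · subst hj; simp [h]
      · simp [hj]
  simp_rw [this]
  rw [Finset.sum_comm]
  simp

/-- The net flow out of the vertex `v` of a flow `m` along the edges. -/
noncomputable def netFlow [Fintype E] (G : FinGraph V E) (m : E → ℝ) (v : V) : ℝ :=
  (∑ e, if G.src e = v then m e else 0) - ∑ e, if G.tgt e = v then m e else 0

theorem netFlow_sub [Fintype E] (G : FinGraph V E) (m n : E → ℝ) (v : V) :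
    G.netFlow (fun e => m e - n e) v = G.netFlow m v - G.netFlow n v := by
  have : ∀ a : E → V, (∑ e, if a e = v then m e - n e else 0) =
      (∑ e, if a e = v then m e else 0) - ∑ e, if a e = v then n e else 0 := by
    intro a
    rw [← Finset.sum_sub_distrib]
    refine Finset.sum_congr rfl fun j _ => ?_
    split_ifs <;> simp
  rw [netFlow, this, this, netFlow, netFlow]
  ring

/-- Summation by parts on the graph. With `y = 1` it yields that principal divisors have degree
zero, and with vertex values as `y` the energy identity. -/
theorem sum_mul_netFlow [Fintype V] [Fintype E] (G : FinGraph V E) (m : E → ℝ) (y : V → ℝ) :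
    ∑ v, y v * G.netFlow m v = ∑ e, m e * (y (G.src e) - y (G.tgt e)) := by
  have key : ∀ a : E → V, ∑ v, y v * (∑ e, if a e = v then m e else 0) =
      ∑ e, m e * y (a e) := by
    intro a
    simp_rw [Finset.mul_sum]
    rw [Finset.sum_comm]
    simp [mul_comm]
  simp_rw [netFlow, mul_sub, Finset.sum_sub_distrib]
  rw [key, key]

/-- The equations that express that the chips `σ j` at parameter `t j` on the edge `c j` form the
divisor of a rational function, which has the value `y v` at the vertex `v` and starts along the
edge `e` with slope `m e` (before any chip at the origin of `e`). -/
def SlopesSolve [Fintype E] (G : FinGraph V E) (ℓ : E → ℝ) (c : J → E) (t : J → ℝ) (σ : J → ℤ)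
    (m : E → ℤ) (y : V → ℝ) : Prop :=
  (∀ e, y (G.tgt e) = y (G.src e) + m e * ℓ e -
      ∑ j, if c j = e then (σ j : ℝ) * (ℓ e - t j) else 0) ∧
    ∀ v, G.netFlow (fun e => m e) v = - ∑ j, if G.tgt (c j) = v then (σ j : ℝ) else 0

/-- On each edge `f` is given by an initial value, an initial slope and the positions of chips. -/
def IsProfile (G : FinGraph V E) (ℓ : E → ℝ) (c : J → E) (t : J → ℝ) (σ : J → ℤ)
    (m : E → ℤ) (f : G.Point ℓ → ℝ) : Prop :=
  ∀ e, ∀ s ∈ Icc 0 (ℓ e),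
    f (G.edgeMap ℓ e s) = f (Point.vertex (G.src e)) + m e * s - bend c t σ e s

variable {m : E → ℤ} {f : G.Point ℓ → ℝ}

theorem IsProfile.forwardSlope (hf : G.IsProfile ℓ c t σ m f) {e : E} {s : ℝ} (h0 : 0 ≤ s)
    (h1 : s < ℓ e) :
    G.forwardSlope ℓ f e s = m e - ∑ j, if c j = e ∧ t j ≤ s then (σ j : ℝ) else 0 := by
  refine RightAffine.derivWithin_eq ?_
  refine ((rightAffine_affine (f (Point.vertex (G.src e))) (m e) s).add
    (rightAffine_bend c t σ e s).neg).congr h1 fun x hx => ?_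
  rw [hf e x ⟨h0.trans hx.1, hx.2.le⟩, sub_eq_add_neg]

theorem IsProfile.backwardSlope (hf : G.IsProfile ℓ c t σ m f) {e : E} {s : ℝ} (h0 : 0 < s)
    (h1 : s ≤ ℓ e) :
    G.backwardSlope ℓ f e s = -(m e - ∑ j, if c j = e ∧ t j < s then (σ j : ℝ) else 0) := by
  rw [FinGraph.backwardSlope, neg_inj]
  refine LeftAffine.derivWithin_eq ?_
  refine ((leftAffine_affine (f (Point.vertex (G.src e))) (m e) s).add
    (leftAffine_bend c t σ e s).neg).congr h0 fun x hx => ?_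
  rw [hf e x ⟨hx.1.le, hx.2.trans h1⟩, sub_eq_add_neg]

/-- At interior points the profile has the right divisor by construction. At a vertex the sums that
depend on chip positions cancel, leaving an equation free of `ℓ` and `t`. -/
theorem IsProfile.divisor_eq_iff [Fintype E] (hℓ : ∀ e, 0 < ℓ e)
    (ht : ∀ j, 0 ≤ t j ∧ t j ≤ ℓ (c j)) (hf : G.IsProfile ℓ c t σ m f) :
    (∀ P, (G.chipDivisor ℓ c t σ P : ℝ) = - G.slopeSum ℓ f P) ↔
      ∀ v, G.netFlow (fun e => m e) v = - ∑ j, if G.tgt (c j) = v then (σ j : ℝ) else 0 := by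
  have hv : ∀ v, (G.chipDivisor ℓ c t σ (Point.vertex v) : ℝ) + G.slopeSum ℓ f (Point.vertex v) =
      G.netFlow (fun e => m e) v + ∑ j, if G.tgt (c j) = v then (σ j : ℝ) else 0 := by
    intro v
    have h1 : (∑ e : E, if G.src e = v then G.forwardSlope ℓ f e 0 else 0) =
        (∑ e, if G.src e = v then (m e : ℝ) else 0) -
          ∑ j, if G.src (c j) = v ∧ t j ≤ 0 then (σ j : ℝ) else 0 := by
      rw [← sum_fiber c (fun e => G.src e = v) (fun _ j => t j ≤ 0), ← Finset.sum_sub_distrib]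
      refine Finset.sum_congr rfl fun e _ => ?_
      split_ifs
      · rw [hf.forwardSlope le_rfl (hℓ e)]
      · simp
    have h2 : (∑ e : E, if G.tgt e = v then G.backwardSlope ℓ f e (ℓ e) else 0) =
        - (∑ e, if G.tgt e = v then (m e : ℝ) else 0) +
          ∑ j, if G.tgt (c j) = v ∧ t j < ℓ (c j) then (σ j : ℝ) else 0 := by
      rw [← sum_fiber c (fun e => G.tgt e = v) (fun e j => t j < ℓ e),
        ← Finset.sum_neg_distrib, ← Finset.sum_add_distrib]
      refine Finset.sum_congr rfl fun e _ => ?_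
      split_ifs
      · rw [hf.backwardSlope (hℓ e) le_rfl]; ring
      · simp
    rw [chipDivisor_vertex hℓ ht, slopeSum, h1, h2, netFlow]
    ring
  constructor
  · intro h v
    linarith [hv v, h (Point.vertex v)]
  · rintro h (v | ⟨e, s, h0, h1⟩)
    · linarith [hv v, h v]
    · rw [slopeSum, hf.forwardSlope h0.le h1, hf.backwardSlope h0 h1.le, chipDivisor_inner]
      ring

theorem SlopesSolve.isPrincipal [Fintype E] (hℓ : ∀ e, 0 < ℓ e)
    (ht : ∀ j, 0 ≤ t j ∧ t j ≤ ℓ (c j)) {y : V → ℝ} (h : G.SlopesSolve ℓ c t σ m y) :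
    IsPrincipal (G.chipDivisor ℓ c t σ) := by
  let f : G.Point ℓ → ℝ := fun P => match P with
    | Point.vertex v => y v
    | Point.inner e s _ _ => y (G.src e) + m e * s - bend c t σ e s
  have hf : G.IsProfile ℓ c t σ m f := by
    intro e s hs
    rcases hs.1.eq_or_lt with rfl | h0
    · rw [edgeMap_zero, bend_zero fun j => (ht j).1]; ring
    rcases hs.2.eq_or_lt with rfl | h1
    · rw [edgeMap_length (hℓ e), bend_length fun j => (ht j).2]; exact h.1 e
    · rw [edgeMap_of_mem_Ioo h0 h1]
  refine ⟨f, ⟨?_, ?_⟩, (hf.divisor_eq_iff hℓ ht).2 h.2⟩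
  · refine continuous_of_comp_edgeMap fun e => ?_
    refine ContinuousOn.congr (f := fun s => f (Point.vertex (G.src e)) + m e * s - bend c t σ e s)
      ?_ (fun s hs => hf e s hs)
    have := continuous_bend c t σ e
    fun_prop
  · intro e
    refine ⟨Finset.univ.image t, fun a b ha hab hb hS => ?_⟩
    -- Between break points the slope is the initial one less the chips already passed.
    refine ⟨m e - ∑ j, if c j = e ∧ t j ≤ a then σ j else 0,
      f (Point.vertex (G.src e)) + ∑ j, if c j = e ∧ t j ≤ a then (σ j : ℝ) * t j else 0,
      fun s hs => ?_⟩
    have hb' : bend c t σ e s = (∑ j, if c j = e ∧ t j ≤ a then (σ j : ℝ) else 0) * s -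
        ∑ j, if c j = e ∧ t j ≤ a then (σ j : ℝ) * t j else 0 := by
      rw [bend, Finset.sum_mul, ← Finset.sum_sub_distrib]
      refine Finset.sum_congr rfl fun j _ => ?_
      by_cases hj : c j = e
      · by_cases hta : t j ≤ a
        · simp only [hj, hta, and_self, if_true]
          rw [max_eq_right (by linarith [hs.1])]; ring
        · have : s ≤ t j := by
            by_contra! hlt
            exact hS (t j) ⟨not_le.1 hta, hlt.trans hs.2⟩ (by simp)
          simp only [hj, hta, and_false, if_true, if_false]
          rw [max_eq_left (by linarith)]; ring
      · simp [hj]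
    rw [hf e s ⟨ha.trans hs.1.le, hs.2.le.trans hb⟩, hb']
    push_cast
    ring

theorem isPrincipal_chipDivisor_iff [Fintype E] (hℓ : ∀ e, 0 < ℓ e)
    (ht : ∀ j, 0 ≤ t j ∧ t j ≤ ℓ (c j)) :
    IsPrincipal (G.chipDivisor ℓ c t σ) ↔ ∃ m y, G.SlopesSolve ℓ c t σ m y := by
  refine ⟨?_, fun ⟨m, y, h⟩ => h.isPrincipal hℓ ht⟩
  rintro ⟨f, hrat, hdiv⟩
  have hm : ∀ e, ∃ m : ℤ, ∀ s ∈ Icc 0 (ℓ e),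
      f (G.edgeMap ℓ e s) = f (Point.vertex (G.src e)) + m * s - bend c t σ e s := by
    intro e
    -- Adding `bend` removes every kink of `f` inside the edge, since the divisor of `f` prescribes
    -- the jumps of its slope.
    obtain ⟨m, hm⟩ := exists_affine_of_locally_affine
      (k := fun s => f (G.edgeMap ℓ e s) + bend c t σ e s) (hℓ e)
      ((continuousOn_comp_edgeMap hrat.continuous e).add (continuous_bend c t σ e).continuousOn)
      (by
        intro s hs
        obtain ⟨p, hp⟩ := hrat.rightAffine hs.1.le hs.2
        obtain ⟨q, hq⟩ := hrat.leftAffine hs.1 hs.2.le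
        have h := hdiv (Point.inner e s hs.1 hs.2)
        rw [chipDivisor_inner, slopeSum, forwardSlope, FinGraph.backwardSlope,
          hp.derivWithin_eq, hq.derivWithin_eq] at h
        refine ⟨p + ∑ j, if c j = e ∧ t j ≤ s then σ j else 0, ?_, ?_⟩
        · have := hp.add (rightAffine_bend c t σ e s)
          push_cast
          exact this
        · have := hq.add (leftAffine_bend c t σ e s)
          push_cast
          convert this using 1
          linarith)
    refine ⟨m, fun s hs => ?_⟩
    have := hm s hs
    simp only [edgeMap_zero, bend_zero fun j => (ht j).1] at this
    linarith
  choose m hm using hm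
  have hf : G.IsProfile ℓ c t σ m f := hm
  refine ⟨m, fun v => f (Point.vertex v), fun e => ?_, (hf.divisor_eq_iff hℓ ht).1 hdiv⟩
  have := hf e (ℓ e) ⟨(hℓ e).le, le_rfl⟩
  rwa [edgeMap_length (hℓ e), bend_length fun j => (ht j).2] at this

end

/-! ### Degrees, chip positions and linear equivalence. -/

section Degree

variable {V : Type*} {E : Type*} {G : FinGraph V E} {ℓ : E → ℝ}

theorem deg_add (D F : G.Divisor ℓ) : deg (D + F) = deg D + deg F :=
  Finsupp.sum_add_index' (fun _ => rfl) (fun _ _ _ => rfl)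

theorem deg_neg (D : G.Divisor ℓ) : deg (-D) = -deg D := by
  have h := deg_add D (-D)
  rw [add_neg_cancel] at h
  have h0 : deg (0 : G.Divisor ℓ) = 0 := Finsupp.sum_zero_index
  omega

theorem deg_sub (D F : G.Divisor ℓ) : deg (D - F) = deg D - deg F := by
  rw [sub_eq_add_neg, deg_add, deg_neg, ← sub_eq_add_neg]

theorem deg_single (P : G.Point ℓ) (n : ℤ) : deg (Finsupp.single P n) = n :=
  Finsupp.sum_single_index rfl

theorem deg_nonneg {D : G.Divisor ℓ} (hD : 0 ≤ D) : 0 ≤ deg D :=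
  Finset.sum_nonneg fun P _ => hD P

theorem deg_sum {J : Type*} (s : Finset J) (D : J → G.Divisor ℓ) :
    deg (∑ j ∈ s, D j) = ∑ j ∈ s, deg (D j) := by
  induction s using Finset.induction_on with
  | empty => exact Finsupp.sum_zero_index
  | insert a s ha ih => rw [Finset.sum_insert ha, Finset.sum_insert ha, deg_add, ih]

theorem deg_chipDivisor {J : Type*} [Fintype J] (c : J → E) (t : J → ℝ) (σ : J → ℤ) :
    deg (G.chipDivisor ℓ c t σ) = ∑ j, σ j := by
  simp [chipDivisor, deg_sum, deg_single]

theorem single_nonneg (P : G.Point ℓ) {n : ℤ} (hn : 0 ≤ n) :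
    (0 : G.Divisor ℓ) ≤ Finsupp.single P n :=
  Finsupp.single_nonneg.2 hn

/-- An effective divisor of degree `k` is a sum of `k` points. -/
theorem exists_eq_sum_single (k : ℕ) {F : G.Divisor ℓ} (hF : 0 ≤ F) (hk : deg F = k) :
    ∃ P : Fin k → G.Point ℓ, F = ∑ i, Finsupp.single (P i) 1 := by
  induction k generalizing F with
  | zero =>
    refine ⟨Fin.elim0, ?_⟩
    have h : ∀ P ∈ F.support, F P = 0 :=
      (Finset.sum_eq_zero_iff_of_nonneg fun P _ => hF P).1 (by exact_mod_cast hk)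
    ext P
    by_cases hP : P ∈ F.support
    · simpa using h P hP
    · simpa using hP
  | succ k ih =>
    obtain ⟨P, hP⟩ : ∃ P, F P ≠ 0 := by
      by_contra! h
      have : F = 0 := Finsupp.ext h
      rw [this] at hk
      have h0 : deg (0 : G.Divisor ℓ) = 0 := Finsupp.sum_zero_index
      omega
    have hP1 : 1 ≤ F P := lt_of_le_of_ne (hF P) (Ne.symm hP)
    obtain ⟨Q, hQ⟩ := ih (F := F - Finsupp.single P 1)
      (by
        intro x
        by_cases hx : P = x
        · subst hx; simpa using hP1
        · simpa [Finsupp.single_apply, hx] using hF x)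
      (by rw [deg_sub, deg_single, hk]; push_cast; ring)
    refine ⟨Fin.cons P Q, ?_⟩
    rw [Fin.sum_univ_succ]
    simp [← hQ]

theorem nonempty_vertices (G : FinGraph V E) : Nonempty V := G.connected.nonempty

theorem nonempty_point : Nonempty (G.Point ℓ) :=
  (nonempty_vertices G).map Point.vertex

/-- In a graph with an edge, every point lies on an edge. -/
theorem exists_edgeMap_eq [Nonempty E] (hℓ : ∀ e, 0 < ℓ e) (P : G.Point ℓ) :
    ∃ e t, (0 ≤ t ∧ t ≤ ℓ e) ∧ G.edgeMap ℓ e t = P := by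
  rcases P with v | ⟨e, t, h0, h1⟩
  · obtain ⟨e₀⟩ := ‹Nonempty E›
    -- An edge has two distinct ends, so connectedness gives `v` a neighbour and hence an incident
    -- edge.
    have : Nontrivial V := ⟨⟨_, _, G.loopless e₀⟩⟩
    obtain ⟨w, hw⟩ := G.connected.preconnected.exists_adj_of_nontrivial v
    rw [SimpleGraph.fromRel_adj] at hw
    rcases hw.2 with ⟨e, he, -⟩ | ⟨e, -, he⟩
    · exact ⟨e, 0, ⟨le_rfl, (hℓ e).le⟩, by rw [edgeMap_zero, he]⟩
    · exact ⟨e, ℓ e, ⟨(hℓ e).le, le_rfl⟩, by rw [edgeMap_length (hℓ e), he]⟩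
  · exact ⟨e, t, ⟨h0.le, h1.le⟩, edgeMap_of_mem_Ioo h0 h1⟩

theorem subsingleton_vertices [IsEmpty E] (G : FinGraph V E) : Subsingleton V := by
  refine not_nontrivial_iff_subsingleton.1 fun _ => ?_
  obtain ⟨v⟩ := nonempty_vertices G
  obtain ⟨w, hw⟩ := G.connected.preconnected.exists_adj_of_nontrivial v
  rw [SimpleGraph.fromRel_adj] at hw
  rcases hw.2 with ⟨e, -⟩ | ⟨e, -⟩ <;> exact isEmptyElim e

theorem subsingleton_point [IsEmpty E] : Subsingleton (G.Point ℓ) := by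
  have := subsingleton_vertices G
  constructor
  rintro (v | ⟨e, _⟩) (w | ⟨e', _⟩)
  · rw [Subsingleton.elim v w]
  · exact (IsEmpty.false e').elim
  all_goals exact (IsEmpty.false e).elim

/-- Finitely many points of a graph with an edge can be put on edges simultaneously. -/
theorem exists_chipDivisor_eq [Nonempty E] (hℓ : ∀ e, 0 < ℓ e) (s : Finset (G.Point ℓ)) :
    ∃ (c : s → E) (t : s → ℝ), (∀ j, 0 ≤ t j ∧ t j ≤ ℓ (c j)) ∧
      ∀ D : G.Divisor ℓ, D.support ⊆ s → D = G.chipDivisor ℓ c t fun j => D j := by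
  choose c t ht hP using exists_edgeMap_eq (G := G) hℓ
  refine ⟨fun j => c j, fun j => t j, fun j => ht j, fun D hD => ?_⟩
  simp only [chipDivisor, hP]
  rw [Finset.sum_coe_sort s fun P => Finsupp.single P (D P)]
  rw [← Finsupp.sum_of_support_subset D hD Finsupp.single fun _ _ => Finsupp.single_zero _,
    D.sum_single]

variable [Fintype E]

theorem IsPrincipal.eq_zero [IsEmpty E] {D : G.Divisor ℓ} (h : IsPrincipal D) : D = 0 := by
  obtain ⟨f, -, hf⟩ := h
  ext (v | ⟨e, _⟩)
  · simpa [slopeSum] using hf (Point.vertex v)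
  · exact (IsEmpty.false e).elim

theorem isPrincipal_zero : IsPrincipal (0 : G.Divisor ℓ) := by
  refine ⟨fun _ => 0, ⟨continuous_const, fun e => ⟨∅, fun _ _ _ _ _ _ => ⟨0, 0, by simp⟩⟩⟩, ?_⟩
  rintro (v | ⟨e, _⟩) <;> simp [slopeSum, forwardSlope, backwardSlope]

/-- With both supports placed at one common family of chips, the equations are linear in `(σ, m,
y)`, so solutions can be subtracted. -/
theorem IsPrincipal.sub (hℓ : ∀ e, 0 < ℓ e) {D F : G.Divisor ℓ} (hD : IsPrincipal D)
    (hF : IsPrincipal F) : IsPrincipal (D - F) := by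
  cases isEmpty_or_nonempty E
  · rw [hD.eq_zero, hF.eq_zero, sub_zero]; exact isPrincipal_zero
  obtain ⟨c, t, ht, hs⟩ := exists_chipDivisor_eq (G := G) hℓ (D.support ∪ F.support)
  rw [hs D Finset.subset_union_left, isPrincipal_chipDivisor_iff hℓ ht] at hD
  rw [hs F Finset.subset_union_right, isPrincipal_chipDivisor_iff hℓ ht] at hF
  rw [hs (D - F) Finsupp.support_sub, isPrincipal_chipDivisor_iff hℓ ht]
  obtain ⟨m, y, h1, h2⟩ := hD
  obtain ⟨n, z, h3, h4⟩ := hF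
  refine ⟨m - n, y - z, fun e => ?_, fun v => ?_⟩
  · have : (∑ j, if c j = e then (((D - F) j : ℤ) : ℝ) * (ℓ e - t j) else 0) =
        (∑ j, if c j = e then ((D j : ℤ) : ℝ) * (ℓ e - t j) else 0) -
          ∑ j, if c j = e then ((F j : ℤ) : ℝ) * (ℓ e - t j) else 0 := by
      rw [← Finset.sum_sub_distrib]
      refine Finset.sum_congr rfl fun j _ => ?_
      split_ifs
      · simp; ring
      · simp
    rw [this, Pi.sub_apply, Pi.sub_apply, h1 e, h3 e]
    simp only [Pi.sub_apply]
    push_cast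
    ring
  · have : (∑ j, if G.tgt (c j) = v then (((D - F) j : ℤ) : ℝ) else 0) =
        (∑ j, if G.tgt (c j) = v then ((D j : ℤ) : ℝ) else 0) -
          ∑ j, if G.tgt (c j) = v then ((F j : ℤ) : ℝ) else 0 := by
      rw [← Finset.sum_sub_distrib]
      refine Finset.sum_congr rfl fun j _ => ?_
      split_ifs <;> simp
    have key : G.netFlow (fun e => ((m - n) e : ℤ)) v =
        G.netFlow (fun e => m e) v - G.netFlow (fun e => n e) v := by
      simp only [Pi.sub_apply, Int.cast_sub]
      exact netFlow_sub G _ _ v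
    rw [this, key, h2, h4]
    ring

theorem IsPrincipal.deg_eq_zero [Fintype V] (hℓ : ∀ e, 0 < ℓ e) {D : G.Divisor ℓ}
    (hD : IsPrincipal D) : deg D = 0 := by
  cases isEmpty_or_nonempty E
  · rw [hD.eq_zero]; exact Finsupp.sum_zero_index
  obtain ⟨c, t, ht, hs⟩ := exists_chipDivisor_eq (G := G) hℓ D.support
  have h := hs D subset_rfl
  rw [h, isPrincipal_chipDivisor_iff hℓ ht] at hD
  obtain ⟨m, y, -, h2⟩ := hD
  rw [h, deg_chipDivisor]
  have h3 := sum_mul_netFlow G (fun e => (m e : ℝ)) 1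
  simp only [Pi.one_apply, one_mul, sub_self, mul_zero, Finset.sum_const_zero] at h3
  simp_rw [h2] at h3
  rw [Finset.sum_neg_distrib, neg_eq_zero, Finset.sum_comm] at h3
  simp only [Finset.sum_ite_eq, Finset.mem_univ, if_true] at h3
  exact_mod_cast h3

theorem nonempty_of_nonempty_sub {D F : G.Divisor ℓ} (hF : 0 ≤ F)
    (h : (linearSystem (D - F)).Nonempty) : (linearSystem D).Nonempty := by
  obtain ⟨A, hA, hp⟩ := h
  refine ⟨A + F, add_nonneg hA hF, ?_⟩
  convert hp using 1
  abel

theorem nonempty_of_le_rank {D : G.Divisor ℓ} {k : ℤ} (hk : 0 ≤ k)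
    (h : k ≤ rank D) : (linearSystem D).Nonempty := by
  by_contra hne
  rw [rank, if_neg hne] at h
  omega

end Degree

/-! ### The rank as a family of conditions, and a normal form for linear systems. -/

section Rank

variable {V : Type*} {E : Type*} [Fintype V] [Fintype E] {G : FinGraph V E} {ℓ : E → ℝ}

theorem deg_eq_of_mem_linearSystem (hℓ : ∀ e, 0 < ℓ e) {D F : G.Divisor ℓ}
    (h : F ∈ linearSystem D) : deg F = deg D := by
  have := h.2.deg_eq_zero hℓ
  rw [deg_sub] at this
  omega

theorem deg_nonneg_of_nonempty (hℓ : ∀ e, 0 < ℓ e) {D : G.Divisor ℓ}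
    (h : (linearSystem D).Nonempty) : 0 ≤ deg D := by
  obtain ⟨F, hF⟩ := h
  rw [← deg_eq_of_mem_linearSystem hℓ hF]
  exact deg_nonneg hF.1

/-- The set in the definition of the rank is bounded by `deg D`, so its supremum `K` is attained. A
divisor `F` of smaller degree is padded to degree `K` by multiples of a point. -/
theorem le_rank_iff (hℓ : ∀ e, 0 < ℓ e) {D : G.Divisor ℓ} {k : ℤ} (hk : 0 ≤ k) :
    k ≤ rank D ↔ ∀ F : G.Divisor ℓ, 0 ≤ F → deg F = k → (linearSystem (D - F)).Nonempty := by
  obtain ⟨P⟩ := nonempty_point (G := G) (ℓ := ℓ)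
  have hbdd : (linearSystem D).Nonempty → BddAbove {k : ℤ | ∀ F : G.Divisor ℓ, 0 ≤ F → deg F = k →
      (linearSystem (D - F)).Nonempty} := by
    refine fun hne => ⟨deg D, fun n hn => ?_⟩
    rcases lt_or_ge n 0 with h | h
    · linarith [deg_nonneg_of_nonempty hℓ hne]
    · have := deg_nonneg_of_nonempty hℓ (hn _ (single_nonneg P h) (deg_single P n))
      rw [deg_sub, deg_single] at this
      linarith
  constructor
  · intro h F hF hdeg
    unfold rank at h
    split_ifs at h with hne
    · have hmem := Int.csSup_mem (s := {k : ℤ | ∀ F : G.Divisor ℓ, 0 ≤ F → deg F = k →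
        (linearSystem (D - F)).Nonempty}) ⟨0, fun F hF h0 => by
          obtain ⟨P, rfl⟩ := exists_eq_sum_single 0 hF (by exact_mod_cast h0)
          simpa using hne⟩ (hbdd hne)
      set K := sSup {k : ℤ | ∀ F : G.Divisor ℓ, 0 ≤ F → deg F = k →
        (linearSystem (D - F)).Nonempty} with hK
      have hKk : 0 ≤ K - k := by linarith
      refine nonempty_of_nonempty_sub (single_nonneg P hKk) ?_
      rw [sub_sub]
      refine hmem _ (add_nonneg hF (single_nonneg P hKk)) ?_
      rw [deg_add, deg_single]
      omega
    · omega
  · intro h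
    have hne : (linearSystem D).Nonempty :=
      nonempty_of_nonempty_sub (single_nonneg P hk) (h _ (single_nonneg P hk) (deg_single P k))
    rw [rank, if_pos hne]
    exact le_csSup (hbdd hne) h

theorem neg_one_le_rank (hℓ : ∀ e, 0 < ℓ e) (D : G.Divisor ℓ) : -1 ≤ rank D := by
  by_cases hne : (linearSystem D).Nonempty
  · have : 0 ≤ rank D := (le_rank_iff hℓ le_rfl).2 fun F hF h0 => by
      obtain ⟨P, rfl⟩ := exists_eq_sum_single 0 hF (by exact_mod_cast h0)
      simpa using hne
    omega
  · rw [rank, if_neg hne]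

theorem le_deg_of_le_rank (hℓ : ∀ e, 0 < ℓ e) {D : G.Divisor ℓ} {k : ℤ} (hk : 0 ≤ k)
    (h : k ≤ rank D) : k ≤ deg D := by
  obtain ⟨P⟩ := nonempty_point (G := G) (ℓ := ℓ)
  have := deg_nonneg_of_nonempty hℓ
    ((le_rank_iff hℓ hk).1 h _ (single_nonneg P hk) (deg_single P k))
  rw [deg_sub, deg_single] at this
  linarith

theorem le_rank_sub_single (hℓ : ∀ e, 0 < ℓ e) {D : G.Divisor ℓ} {k : ℤ} (hk : 0 ≤ k)
    (h : k + 1 ≤ rank D) (P : G.Point ℓ) : k ≤ rank (D - Finsupp.single P 1) := by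
  refine (le_rank_iff hℓ hk).2 fun F hF hdeg => ?_
  rw [sub_sub]
  refine (le_rank_iff hℓ (by omega)).1 h _ (add_nonneg (single_nonneg P zero_le_one) hF) ?_
  rw [deg_add, deg_single]
  omega

/-- Subtracting a point lowers the rank by at most one and the degree by one, so the descent reaches
rank exactly `r`; the rank is at most the degree, which stops it. -/
theorem exists_rank_eq (hℓ : ∀ e, 0 < ℓ e) {r : ℤ} (hr : 0 ≤ r) (n : ℕ) {D : G.Divisor ℓ}
    (hn : deg D ≤ n) (hD : r ≤ rank D) : ∃ D' : G.Divisor ℓ, deg D' ≤ deg D ∧ rank D' = r := by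
  induction n generalizing D with
  | zero =>
    have h1 : rank D ≤ deg D := le_deg_of_le_rank hℓ (hr.trans hD) le_rfl
    exact ⟨D, le_rfl, by push_cast at hn; omega⟩
  | succ n ih =>
    rcases hD.eq_or_lt with h | h
    · exact ⟨D, le_rfl, h.symm⟩
    obtain ⟨P⟩ := nonempty_point (G := G) (ℓ := ℓ)
    have hdeg : deg (D - Finsupp.single P 1) = deg D - 1 := by rw [deg_sub, deg_single]
    obtain ⟨D', h1, h2⟩ := ih (D := D - Finsupp.single P 1) (by push_cast at hn; omega)
      (le_rank_sub_single hℓ hr (by omega) P)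
    exact ⟨D', by omega, h2⟩

theorem hasLinearSystem_iff (hℓ : ∀ e, 0 < ℓ e) {r d : ℤ} (hr : 0 ≤ r) :
    G.HasLinearSystem ℓ r d ↔ ∃ D : G.Divisor ℓ, 0 ≤ D ∧ deg D = d ∧ r ≤ rank D := by
  constructor
  · rintro ⟨D, hd, hD⟩
    obtain ⟨P⟩ := nonempty_point (G := G) (ℓ := ℓ)
    obtain ⟨A, hA⟩ := nonempty_of_le_rank hr hD.ge
    have hn : 0 ≤ d - deg D := by linarith
    -- An effective representative is padded to degree exactly `d`, which cannot lower the rank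
    -- below `r`.
    refine ⟨A + Finsupp.single P (d - deg D), add_nonneg hA.1 (single_nonneg P hn), ?_, ?_⟩
    · rw [deg_add, deg_single, deg_eq_of_mem_linearSystem hℓ hA]; ring
    · refine (le_rank_iff hℓ hr).2 fun F hF hdeg => ?_
      obtain ⟨B, hB, hp⟩ := (le_rank_iff hℓ hr).1 hD.ge F hF hdeg
      refine ⟨B + Finsupp.single P (d - deg D), add_nonneg hB (single_nonneg P hn), ?_⟩
      convert hp.sub hℓ hA.2 using 1
      abel
  · rintro ⟨D, -, hd, hD⟩
    obtain ⟨D', h1, h2⟩ := exists_rank_eq hℓ hr (deg D).toNat (Int.self_le_toNat _) hD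
    exact ⟨D', by omega, h2⟩

theorem not_hasLinearSystem (hℓ : ∀ e, 0 < ℓ e) {r : ℤ} (hr : r < -1) (d : ℤ) :
    ¬ G.HasLinearSystem ℓ r d := by
  rintro ⟨D, -, h⟩
  have := neg_one_le_rank hℓ D
  omega

theorem hasLinearSystem_neg_one (hℓ : ∀ e, 0 < ℓ e) (d : ℤ) : G.HasLinearSystem ℓ (-1) d := by
  obtain ⟨P⟩ := nonempty_point (G := G) (ℓ := ℓ)
  -- Negative degree rules out effective representatives.
  refine ⟨Finsupp.single P (min d (-1)), by simp [deg_single], if_neg fun h => ?_⟩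
  have := deg_nonneg_of_nonempty hℓ h
  rw [deg_single] at this
  omega

end Rank

/-! ### Being principal is a closed condition. -/

section Closed

variable {V : Type*} {E : Type*} [Fintype V] [Fintype E] {J : Type*} [Fintype J]
  {G : FinGraph V E} {c : J → E} {σ : J → ℤ}

/-- The slopes of a rational function are bounded in terms of the number of chips in its divisor
and of bounds for the edge lengths. -/
theorem SlopesSolve.slope_bound {ℓ : E → ℝ} {t : J → ℝ} {m n : E → ℤ} {y : V → ℝ} {a b : ℝ}
    (ha : 0 < a) (hℓ : ∀ e, a ≤ ℓ e ∧ ℓ e ≤ b) (ht : ∀ j, 0 ≤ t j ∧ t j ≤ ℓ (c j))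
    (h : G.SlopesSolve ℓ c t σ m y)
    (hn : ∀ v, G.netFlow (fun e => n e) v = - ∑ j, if G.tgt (c j) = v then (σ j : ℝ) else 0)
    (e : E) :
    a * ((m e : ℝ) - n e) ^ 2 ≤
      ∑ _e : E, b * (∑ j, |(σ j : ℝ)| + ∑ e, |(n e : ℝ)|) ^ 2 := by
  set C := ∑ j, |(σ j : ℝ)| + ∑ e, |(n e : ℝ)| with hC
  set w : E → ℝ := fun e => ∑ j, if c j = e then (σ j : ℝ) * (ℓ e - t j) else 0 with hw
  have hpos : ∀ e, 0 < ℓ e := fun e => ha.trans_le (hℓ e).1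
  -- `m - n` is a circulation, hence orthogonal to the differences of `y` along the edges; inserting
  -- the edge equations gives the energy identity.
  have hflow := sum_mul_netFlow G (fun e => (m e : ℝ) - n e) y
  have hz : ∀ v, G.netFlow (fun e => (m e : ℝ) - n e) v = 0 := fun v => by
    rw [netFlow_sub, h.2, hn, sub_self]
  simp_rw [hz, mul_zero, Finset.sum_const_zero] at hflow
  have henergy : ∑ e, ℓ e * ((m e : ℝ) - n e) ^ 2 =
      ∑ e, ((m e : ℝ) - n e) * (w e - n e * ℓ e) := by
    rw [← sub_eq_zero, ← Finset.sum_sub_distrib, ← neg_eq_zero, ← Finset.sum_neg_distrib, hflow]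
    refine Finset.sum_congr rfl fun e _ => ?_
    rw [h.1 e, hw]
    ring
  have hwb : ∀ e, |w e - n e * ℓ e| ≤ ℓ e * C := by
    intro e
    have h1 : |w e| ≤ ℓ e * ∑ j, |(σ j : ℝ)| := by
      rw [hw, Finset.mul_sum]
      refine (Finset.abs_sum_le_sum_abs _ _).trans (Finset.sum_le_sum fun j _ => ?_)
      split_ifs with hj
      · subst hj
        rw [abs_mul, mul_comm]
        refine mul_le_mul_of_nonneg_right ?_ (abs_nonneg _)
        rw [abs_le]
        constructor <;> linarith [ht j, hpos (c j)]
      · rw [abs_zero]; exact mul_nonneg (hpos e).le (abs_nonneg _)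
    have h2 : |(n e : ℝ)| ≤ ∑ e, |(n e : ℝ)| :=
      Finset.single_le_sum (f := fun e => |(n e : ℝ)|) (fun e _ => abs_nonneg _)
        (Finset.mem_univ e)
    calc |w e - n e * ℓ e| ≤ |w e| + |n e * ℓ e| := abs_sub _ _
      _ = |w e| + ℓ e * |(n e : ℝ)| := by rw [abs_mul, abs_of_pos (hpos e), mul_comm]
      _ ≤ ℓ e * ∑ j, |(σ j : ℝ)| + ℓ e * ∑ e, |(n e : ℝ)| :=
          add_le_add h1 (mul_le_mul_of_nonneg_left h2 (hpos e).le)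
      _ = ℓ e * C := by rw [hC]; ring
  have hterm : ∀ e, ((m e : ℝ) - n e) * (w e - n e * ℓ e) ≤
      ℓ e * ((m e : ℝ) - n e) ^ 2 / 2 + b * C ^ 2 / 2 := by
    intro e
    have h1 : ((m e : ℝ) - n e) * (w e - n e * ℓ e) ≤ |(m e : ℝ) - n e| * (ℓ e * C) :=
      (le_abs_self _).trans (by
        rw [abs_mul]; exact mul_le_mul_of_nonneg_left (hwb e) (abs_nonneg _))
    -- The square completes the product so that half of the energy can be absorbed on the left.
    have h2 : 0 ≤ ℓ e * (|(m e : ℝ) - n e| - C) ^ 2 := mul_nonneg (hpos e).le (sq_nonneg _)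
    have h3 : ℓ e * C ^ 2 ≤ b * C ^ 2 := mul_le_mul_of_nonneg_right (hℓ e).2 (sq_nonneg _)
    have h4 := sq_abs ((m e : ℝ) - n e)
    rw [← h4]
    linarith
  have hsum := Finset.sum_le_sum fun e (_ : e ∈ Finset.univ) => hterm e
  rw [← henergy, Finset.sum_add_distrib, ← Finset.sum_div, ← Finset.sum_div] at hsum
  have hsingle : ℓ e * ((m e : ℝ) - n e) ^ 2 ≤ ∑ e, ℓ e * ((m e : ℝ) - n e) ^ 2 :=
    Finset.single_le_sum (f := fun e => ℓ e * ((m e : ℝ) - n e) ^ 2)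
      (fun e _ => mul_nonneg (hpos e).le (sq_nonneg _)) (Finset.mem_univ e)
  have := mul_le_mul_of_nonneg_right (hℓ e).1 (sq_nonneg ((m e : ℝ) - n e))
  linarith

theorem isClosed_slopesSolve (G : FinGraph V E) (c : J → E) (σ : J → ℤ) (m : E → ℤ) :
    IsClosed {q : (E → ℝ) × (J → ℝ) | ∃ y, G.SlopesSolve q.1 c q.2 σ m y} := by
  by_cases hm : ∀ v, G.netFlow (fun e => m e) v =
      - ∑ j, if G.tgt (c j) = v then (σ j : ℝ) else 0
  swap
  · convert isClosed_empty
    exact eq_empty_of_forall_notMem fun q ⟨y, hy⟩ => hm hy.2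
  -- The edge equations say `T y = F q`; the range of `T` is closed, being finite-dimensional, and
  -- `F` is continuous.
  let T : (V → ℝ) →ₗ[ℝ] (E → ℝ) :=
    { toFun := fun y e => y (G.tgt e) - y (G.src e)
      map_add' := fun y z => by ext e; simp; ring
      map_smul' := fun r y => by ext e; simp; ring }
  let F : (E → ℝ) × (J → ℝ) → E → ℝ := fun q e => m e * q.1 e -
    ∑ j, if c j = e then (σ j : ℝ) * (q.1 e - q.2 j) else 0
  have hF : Continuous F := by
    refine continuous_pi fun e => (by fun_prop : Continuous fun q : (E → ℝ) × (J → ℝ) =>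
      (m e : ℝ) * q.1 e).sub (continuous_finsetSum _ fun j _ => ?_)
    split_ifs <;> fun_prop
  convert (LinearMap.range T).closed_of_finiteDimensional.preimage hF using 1
  ext q
  simp only [mem_ofPred_eq, mem_preimage, SetLike.mem_coe, LinearMap.mem_range]
  refine exists_congr fun y => ⟨fun h => ?_, fun h => ⟨fun e => ?_, hm⟩⟩
  · ext e
    have := h.1 e
    change y (G.tgt e) - y (G.src e) = _ - _
    linarith
  · have := congrFun h e
    change y (G.tgt e) - y (G.src e) = _ - _ at this
    linarith

/-- Being the divisor of a rational function is a closed condition on the lengths of the edges and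
the positions of the chips. -/
theorem isClosed_solvable (G : FinGraph V E) (c : J → E) (σ : J → ℤ) {a b : ℝ} (ha : 0 < a) :
    IsClosed {q : (E → ℝ) × (J → ℝ) | (∀ e, a ≤ q.1 e ∧ q.1 e ≤ b) ∧
      (∀ j, 0 ≤ q.2 j ∧ q.2 j ≤ q.1 (c j)) ∧ ∃ m y, G.SlopesSolve q.1 c q.2 σ m y} := by
  by_cases hn : ∃ n : E → ℤ, ∀ v, G.netFlow (fun e => n e) v =
      - ∑ j, if G.tgt (c j) = v then (σ j : ℝ) else 0
  swap
  · convert isClosed_empty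
    exact eq_empty_of_forall_notMem fun q ⟨_, _, m, y, hy⟩ => hn ⟨m, hy.2⟩
  -- `n` serves as a reference flow for all lengths and positions at once, so the bound `K` is
  -- uniform.
  obtain ⟨n, hn⟩ := hn
  set K := (∑ _e : E, b * (∑ j, |(σ j : ℝ)| + ∑ e, |(n e : ℝ)|) ^ 2) / a with hK
  set N : E → ℤ := fun _ => ⌈K⌉
  have hbox : IsClosed {q : (E → ℝ) × (J → ℝ) | (∀ e, a ≤ q.1 e ∧ q.1 e ≤ b) ∧
      ∀ j, 0 ≤ q.2 j ∧ q.2 j ≤ q.1 (c j)} := by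
    simp only [ofPred_and, ofPred_forall]
    refine (isClosed_iInter fun e => ?_).inter (isClosed_iInter fun j => ?_)
    · exact (isClosed_le (by fun_prop) (by fun_prop)).inter
        (isClosed_le (by fun_prop) (by fun_prop))
    · exact (isClosed_le (by fun_prop) (by fun_prop)).inter
        (isClosed_le (by fun_prop) (by fun_prop))
  convert hbox.inter ((finite_Icc (n - N) (n + N)).isClosed_biUnion
    fun m _ => isClosed_slopesSolve G c σ m) using 1
  ext q
  simp only [mem_ofPred_eq, mem_inter_iff, mem_iUnion, exists_prop]
  constructor
  · rintro ⟨hℓ, ht, m, y, h⟩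
    refine ⟨⟨hℓ, ht⟩, m, ?_, y, h⟩
    have hle : ∀ e, |m e - n e| ≤ ⌈K⌉ := by
      intro e
      have h1 := h.slope_bound ha hℓ ht hn e
      have h2 : ((m e : ℝ) - n e) ^ 2 ≤ K := by
        rw [hK, le_div_iff₀ ha, mul_comm]; exact h1
      have h3 : |m e - n e| ≤ (m e - n e) ^ 2 := by
        rw [← sq_abs]; exact Int.le_self_sq _
      have h4 : (((m e - n e) ^ 2 : ℤ) : ℝ) ≤ ⌈K⌉ := by
        push_cast
        exact h2.trans (Int.le_ceil K)
      exact h3.trans (by exact_mod_cast h4)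
    exact ⟨fun e => by have := (abs_le.1 (hle e)).1; simp only [Pi.sub_apply, N]; omega,
      fun e => by have := (abs_le.1 (hle e)).2; simp only [Pi.add_apply, N]; omega⟩
  · rintro ⟨⟨hℓ, ht⟩, m, -, y, h⟩
    exact ⟨hℓ, ht, m, y, h⟩

end Closed

/-! ### The space of divisors and its compact cells. -/

section Cells

variable {V : Type*} {E : Type*} {G : FinGraph V E} {ℓ : E → ℝ} {ε : ℝ}

theorem LengthBox.pos (hℓ : ∀ e, ε < ℓ e) (L : LengthBox ℓ ε) (e : E) : 0 < L.1 e := by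
  have := (abs_le.1 (L.2 e)).1
  linarith [hℓ e]

/-- An effective divisor of degree `k` is a sum of points given by their relative positions on
edges. -/
theorem exists_eq_chipDivisor [Nonempty E] {ℓ : E → ℝ} (hℓ : ∀ e, 0 < ℓ e) (k : ℕ)
    {F : G.Divisor ℓ} (hF : 0 ≤ F) (hk : deg F = k) :
    ∃ (c : Fin k → E) (x : Fin k → unitInterval),
      F = G.chipDivisor ℓ c (fun i => x i * ℓ (c i)) 1 := by
  obtain ⟨P, rfl⟩ := exists_eq_sum_single k hF hk
  choose c t ht hP using exists_edgeMap_eq (G := G) hℓ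
  refine ⟨fun i => c (P i), fun i => ⟨t (P i) / ℓ (c (P i)),
    div_nonneg (ht _).1 (hℓ _).le, div_le_one_of_le₀ (ht _).2 (hℓ _).le⟩, ?_⟩
  refine Finset.sum_congr rfl fun i _ => ?_
  simp only [Pi.one_apply]
  rw [div_mul_cancel₀ _ (hℓ _).ne', hP]

theorem chipDivisor_sumElim {J K : Type*} [Fintype J] [Fintype K] (c : J → E) (t : J → ℝ)
    (σ : J → ℤ) (c' : K → E) (t' : K → ℝ) (σ' : K → ℤ) :
    G.chipDivisor ℓ (Sum.elim c c') (Sum.elim t t') (Sum.elim σ σ') =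
      G.chipDivisor ℓ c t σ + G.chipDivisor ℓ c' t' σ' := by
  simp [chipDivisor, Fintype.sum_sum_type]

theorem chipDivisor_neg {J : Type*} [Fintype J] (c : J → E) (t : J → ℝ) (σ : J → ℤ) :
    G.chipDivisor ℓ c t (-σ) = - G.chipDivisor ℓ c t σ := by
  simp [chipDivisor]

theorem chipDivisor_one_nonneg {J : Type*} [Fintype J] (c : J → E) (t : J → ℝ) :
    0 ≤ G.chipDivisor ℓ c t 1 :=
  Finset.sum_nonneg fun _ _ => by simp

instance [Fintype E] : CompactSpace (LengthBox ℓ ε) := by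
  refine ⟨Topology.IsInducing.subtypeVal.isCompact_iff.2 ?_⟩
  rw [image_univ, Subtype.range_coe_subtype]
  convert isCompact_univ_pi fun e => isCompact_Icc (a := ℓ e - ε) (b := ℓ e + ε) using 1
  ext ℓ'
  simp only [mem_ofPred_eq, mem_univ_pi, mem_Icc, abs_le]
  refine forall_congr' fun e => ?_
  constructor <;> rintro ⟨h1, h2⟩ <;> constructor <;> linarith

instance [Fintype E] {d : ℕ} (c : Fin d → E) : CompactSpace (Cell ℓ ε c) := by
  refine ⟨Topology.IsInducing.subtypeVal.isCompact_iff.2 ?_⟩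
  rw [image_univ, Subtype.range_coe_subtype]
  have hK : IsCompact (univ ×ˢ univ.pi fun i => Icc 0 (ℓ (c i) + ε) :
      Set (LengthBox ℓ ε × (Fin d → ℝ))) :=
    isCompact_univ.prod (isCompact_univ_pi fun i => isCompact_Icc)
  refine hK.of_isClosed_subset ?_ ?_
  · have h : IsClosed (⋂ i, {p : LengthBox ℓ ε × (Fin d → ℝ) | 0 ≤ p.2 i} ∩
        {p : LengthBox ℓ ε × (Fin d → ℝ) | p.2 i ≤ p.1.1 (c i)}) :=
      isClosed_iInter fun i => (isClosed_le (by fun_prop) (by fun_prop)).inter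
        (isClosed_le (by fun_prop) ((continuous_apply (c i)).comp (by fun_prop)))
    convert h using 1
    ext p
    rw [mem_iInter]
    rfl
  · rintro ⟨L, t⟩ h
    refine ⟨mem_univ _, fun i _ => ⟨(h i).1, (h i).2.trans ?_⟩⟩
    have := (abs_le.1 (L.2 (c i))).2
    linarith

theorem exists_cellMap_eq [Nonempty E] (hℓ : ∀ e, ε < ℓ e) {d : ℕ} (x : G.DivisorSpace ℓ ε d) :
    ∃ c p, G.cellMap ℓ ε c p = x := by
  obtain ⟨L, D, hD, hdeg⟩ := x
  have hL := LengthBox.pos hℓ L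
  obtain ⟨c, t, rfl⟩ := exists_eq_chipDivisor hL d hD hdeg
  refine ⟨c, ⟨(L, fun i => t i * L.1 (c i)), fun i => ⟨mul_nonneg (t i).2.1 (hL _).le,
    mul_le_of_le_one_left (hL _).le (t i).2.2⟩⟩, ?_⟩
  rfl

theorem compactSpace_divisorSpace_of_nonempty [Fintype E] [Nonempty E] (hℓ : ∀ e, ε < ℓ e)
    (d : ℕ) : CompactSpace (G.DivisorSpace ℓ ε d) := by
  have h : (⋃ c : Fin d → E, range (G.cellMap ℓ ε c)) = univ :=
    eq_univ_of_forall fun x => by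
      obtain ⟨c, p, rfl⟩ := exists_cellMap_eq hℓ x
      exact mem_iUnion.2 ⟨c, mem_range_self p⟩
  refine ⟨?_⟩
  rw [← h]
  refine isCompact_iUnion fun c => isCompact_range ?_
  exact continuous_iff_coinduced_le.2
    (le_iSup (fun c : Fin d → E => TopologicalSpace.coinduced (G.cellMap ℓ ε c) inferInstance) c)

theorem isClosed_divisorSpace_iff {d : ℕ} {s : Set (G.DivisorSpace ℓ ε d)} :
    IsClosed s ↔ ∀ c : Fin d → E, IsClosed (G.cellMap ℓ ε c ⁻¹' s) := by
  rw [isClosed_iSup_iff]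
  exact forall_congr' fun c => isClosed_coinduced

theorem continuous_len {d : ℕ} : Continuous (DivisorSpace.len : G.DivisorSpace ℓ ε d → _) :=
  continuous_iSup_dom.2 fun _ => continuous_coinduced_dom.2
    (continuous_fst.comp continuous_subtype_val)

/-- Without edges there are no cells when `d > 0`, so this case cannot be treated through cells. -/
theorem subsingleton_divisorSpace [IsEmpty E] (d : ℕ) : Subsingleton (G.DivisorSpace ℓ ε d) := by
  constructor
  rintro ⟨L, D, hD, hd⟩ ⟨L', D', hD', hd'⟩
  obtain rfl : L = L' := Subtype.ext (Subsingleton.elim _ _)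
  have := subsingleton_point (G := G) (ℓ := L.1)
  obtain ⟨P, rfl⟩ := exists_eq_sum_single d hD hd
  obtain ⟨P', rfl⟩ := exists_eq_sum_single d hD' hd'
  obtain rfl : P = P' := Subsingleton.elim _ _
  rfl

theorem compactSpace_divisorSpace [Fintype E] (hℓ : ∀ e, ε < ℓ e) (d : ℕ) :
    CompactSpace (G.DivisorSpace ℓ ε d) := by
  cases isEmpty_or_nonempty E
  · have := subsingleton_divisorSpace (G := G) (ℓ := ℓ) (ε := ε) d
    infer_instance
  · exact compactSpace_divisorSpace_of_nonempty hℓ d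

end Cells

/-! ### Semicontinuity of the rank and its consequences. -/

section Semicontinuity

variable {V : Type*} {E : Type*} [Fintype V] [Fintype E] {G : FinGraph V E} {ℓ : E → ℝ} {ε : ℝ}

/-- The three blocks of chips are `-D`, `F` and the unknown effective divisor of degree `l`.
Positions of the last two are relative to edge lengths, so that they range over cubes independent of
`ℓ`. -/
theorem le_rank_chipDivisor_iff [Nonempty E] (hℓ : ∀ e, 0 < ℓ e) {k l : ℕ}
    {c : Fin (k + l) → E} {t : Fin (k + l) → ℝ} (ht : ∀ j, 0 ≤ t j ∧ t j ≤ ℓ (c j)) :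
    (k : ℤ) ≤ rank (G.chipDivisor ℓ c t 1) ↔
      ∀ (c' : Fin k → E) (x : Fin k → unitInterval),
        ∃ (c'' : Fin l → E) (z : Fin l → unitInterval), ∃ m y,
          G.SlopesSolve ℓ (Sum.elim c (Sum.elim c' c''))
            (Sum.elim t (Sum.elim (fun i => x i * ℓ (c' i)) fun i => z i * ℓ (c'' i)))
            (Sum.elim (-1) (Sum.elim 1 1)) m y := by
  have hx : ∀ {n : ℕ} (c : Fin n → E) (x : Fin n → unitInterval) (j : Fin n),
      0 ≤ (x j : ℝ) * ℓ (c j) ∧ (x j : ℝ) * ℓ (c j) ≤ ℓ (c j) := fun c x j =>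
    ⟨mul_nonneg (x j).2.1 (hℓ _).le, mul_le_of_le_one_left (hℓ _).le (x j).2.2⟩
  have hkey : ∀ (c' : Fin k → E) (x : Fin k → unitInterval) (c'' : Fin l → E)
      (z : Fin l → unitInterval),
      (∃ m y, G.SlopesSolve ℓ (Sum.elim c (Sum.elim c' c''))
        (Sum.elim t (Sum.elim (fun i => x i * ℓ (c' i)) fun i => z i * ℓ (c'' i)))
        (Sum.elim (-1) (Sum.elim 1 1)) m y) ↔
      G.chipDivisor ℓ c'' (fun i => z i * ℓ (c'' i)) 1 ∈
        linearSystem (G.chipDivisor ℓ c t 1 - G.chipDivisor ℓ c' (fun i => x i * ℓ (c' i)) 1) := by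
    intro c' x c'' z
    rw [← isPrincipal_chipDivisor_iff hℓ, chipDivisor_sumElim, chipDivisor_sumElim,
      chipDivisor_neg]
    · refine Iff.trans ?_ (and_iff_right (chipDivisor_one_nonneg _ _)).symm
      refine iff_of_eq (congrArg _ ?_)
      abel
    · rintro (j | j | j)
      exacts [ht j, hx c' x j, hx c'' z j]
  simp_rw [hkey]
  rw [le_rank_iff hℓ (Int.natCast_nonneg k)]
  constructor
  · intro h c' x
    have hdeg : deg (G.chipDivisor ℓ c' (fun i => x i * ℓ (c' i)) 1) = k := by
      simp [deg_chipDivisor]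
    obtain ⟨A, hA⟩ := h _ (chipDivisor_one_nonneg c' fun i => x i * ℓ (c' i)) hdeg
    obtain ⟨c'', z, rfl⟩ := exists_eq_chipDivisor hℓ l hA.1 (by
      rw [deg_eq_of_mem_linearSystem hℓ hA, deg_sub, hdeg, deg_chipDivisor]; simp)
    exact ⟨c'', z, hA⟩
  · intro h F hF hdeg
    obtain ⟨c', x, rfl⟩ := exists_eq_chipDivisor hℓ k hF hdeg
    obtain ⟨c'', z, hz⟩ := h c' x
    exact ⟨_, hz⟩

theorem isClosed_cell_le_rank [Nonempty E] (hℓ : ∀ e, ε < ℓ e) {k l : ℕ}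
    (c : Fin (k + l) → E) :
    IsClosed {p : Cell ℓ ε c | (k : ℤ) ≤ rank (G.cellMap ℓ ε c p).div} := by
  obtain ⟨a, ha, hae⟩ : ∃ a : ℝ, 0 < a ∧ ∀ e, a ≤ ℓ e - ε := by
    obtain ⟨e₀, h⟩ := Finite.exists_min fun e => ℓ e - ε
    exact ⟨ℓ e₀ - ε, by linarith [hℓ e₀], h⟩
  obtain ⟨b, hb⟩ : ∃ b : ℝ, ∀ e, ℓ e + ε ≤ b := by
    obtain ⟨e₀, h⟩ := Finite.exists_max fun e => ℓ e + ε
    exact ⟨_, h⟩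
  have hset : {p : Cell ℓ ε c | (k : ℤ) ≤ rank (G.cellMap ℓ ε c p).div} =
      ⋂ (c' : Fin k → E) (x : Fin k → unitInterval), ⋃ c'' : Fin l → E,
        Prod.fst '' {q : Cell ℓ ε c × (Fin l → unitInterval) | ∃ m y,
          G.SlopesSolve q.1.1.1.1 (Sum.elim c (Sum.elim c' c''))
            (Sum.elim q.1.1.2 (Sum.elim (fun i => x i * q.1.1.1.1 (c' i))
              fun i => q.2 i * q.1.1.1.1 (c'' i)))
            (Sum.elim (-1) (Sum.elim 1 1)) m y} := by
    ext p
    simp only [mem_ofPred_eq, mem_iInter, mem_iUnion, mem_image, Prod.exists, exists_and_right,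
      exists_eq_right]
    exact le_rank_chipDivisor_iff (LengthBox.pos hℓ _) p.2
  rw [hset]
  -- The intersection may be infinite, but the union runs over finitely many `c''`, and projecting
  -- along the compact cube of the `z` is a closed map.
  refine isClosed_iInter fun c' => isClosed_iInter fun x => isClosed_iUnion_of_finite fun c'' =>
    isClosedMap_fst_of_compactSpace _ ?_
  have hcont : Continuous fun q : Cell ℓ ε c × (Fin l → unitInterval) =>
      ((q.1.1.1.1, Sum.elim q.1.1.2 (Sum.elim (fun i => x i * q.1.1.1.1 (c' i))
        fun i => q.2 i * q.1.1.1.1 (c'' i))) : (E → ℝ) × (Fin (k + l) ⊕ Fin k ⊕ Fin l → ℝ)) := by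
    have hlen : ∀ e, Continuous fun q : Cell ℓ ε c × (Fin l → unitInterval) => q.1.1.1.1 e :=
      fun e => (continuous_apply e).comp (by fun_prop)
    refine Continuous.prodMk (by fun_prop) (continuous_pi ?_)
    rintro (j | j | j) <;> simp only [Sum.elim_inl, Sum.elim_inr]
    · fun_prop
    · exact continuous_const.mul (hlen _)
    · exact Continuous.mul (by fun_prop) (hlen _)
  convert (isClosed_solvable G (Sum.elim c (Sum.elim c' c''))
    (Sum.elim (-1) (Sum.elim 1 1)) (b := b) ha).preimage hcont using 1
  ext q
  simp only [mem_ofPred_eq, mem_preimage]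
  refine ⟨fun h => ⟨fun e => ?_, ?_, h⟩, fun h => h.2.2⟩
  · have := abs_le.1 (q.1.1.1.2 e)
    exact ⟨by linarith [hae e], by linarith [hb e]⟩
  · have hpos := LengthBox.pos hℓ q.1.1.1
    rintro (j | j | j)
    · exact q.1.2 j
    · exact ⟨mul_nonneg (x j).2.1 (hpos _).le, mul_le_of_le_one_left (hpos _).le (x j).2.2⟩
    · exact ⟨mul_nonneg (q.2 j).2.1 (hpos _).le, mul_le_of_le_one_left (hpos _).le (q.2 j).2.2⟩

theorem isClosed_le_rank (hℓ : ∀ e, ε < ℓ e) (d : ℕ) (i : ℤ) :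
    IsClosed {x : G.DivisorSpace ℓ ε d | i ≤ rank x.div} := by
  cases isEmpty_or_nonempty E
  · have := subsingleton_divisorSpace (G := G) (ℓ := ℓ) (ε := ε) d
    have := Subsingleton.discreteTopology (α := G.DivisorSpace ℓ ε d)
    exact isClosed_discrete _
  rcases lt_or_ge i 0 with hi | hi
  · convert isClosed_univ
    refine eq_univ_of_forall fun x => ?_
    have := neg_one_le_rank (LengthBox.pos hℓ x.len) x.div
    change i ≤ _
    omega
  lift i to ℕ using hi
  rcases lt_or_ge d i with hd | hd
  · convert isClosed_empty
    refine eq_empty_of_forall_notMem fun x (hx : (i : ℤ) ≤ _) => ?_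
    have := le_deg_of_le_rank (LengthBox.pos hℓ x.len) (by omega) hx
    have := x.deg_eq
    omega
  obtain ⟨l, rfl⟩ := Nat.exists_eq_add_of_le hd
  exact isClosed_divisorSpace_iff.2 fun c => isClosed_cell_le_rank hℓ c

theorem isClosed_hasLinearSystem (hℓ : ∀ e, ε < ℓ e) (r d : ℤ) :
    IsClosed {ℓ' : LengthBox ℓ ε | G.HasLinearSystem ℓ'.1 r d} := by
  rcases lt_trichotomy r (-1) with hr | rfl | hr
  · convert isClosed_empty
    exact eq_empty_of_forall_notMem fun L => not_hasLinearSystem (LengthBox.pos hℓ L) hr d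
  · convert isClosed_univ
    exact eq_univ_of_forall fun L => hasLinearSystem_neg_one (LengthBox.pos hℓ L) d
  have hr0 : 0 ≤ r := by omega
  rcases lt_or_ge d 0 with hd | hd
  · convert isClosed_empty
    refine eq_empty_of_forall_notMem fun L hL => ?_
    obtain ⟨D, hD, hdeg, -⟩ := (hasLinearSystem_iff (LengthBox.pos hℓ L) hr0).1 hL
    have := deg_nonneg hD
    omega
  lift d to ℕ using hd
  have := compactSpace_divisorSpace (G := G) hℓ d
  -- A closed subset of the compact space `M` has compact, hence closed, image in the box.
  convert ((isClosed_le_rank (G := G) hℓ d r).isCompact.image continuous_len).isClosed using 1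
  ext L
  refine (hasLinearSystem_iff (LengthBox.pos hℓ L) hr0).trans ⟨?_, ?_⟩
  · rintro ⟨D, hD, hdeg, hrank⟩
    exact ⟨⟨L, D, hD, hdeg⟩, hrank, rfl⟩
  · rintro ⟨⟨L, D, hD, hdeg⟩, hrank, rfl⟩
    exact ⟨D, hD, hdeg, hrank⟩

theorem hasLinearSystem_of_tendsto (hε : 0 < ε) (hℓ : ∀ e, ε < ℓ e) {r d : ℤ}
    {L : ℕ → LengthBox ℓ ε} (hL : Tendsto (fun n => (L n).1) atTop (𝓝 ℓ))
    (h : ∀ n, G.HasLinearSystem (L n).1 r d) : G.HasLinearSystem ℓ r d :=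
  (isClosed_hasLinearSystem (G := G) hℓ r d).mem_of_tendsto
    (b := atTop) (f := L) (x := ⟨ℓ, fun e => by simpa using hε.le⟩)
    (tendsto_subtype_rng.2 hL) (Eventually.of_forall h)

theorem exists_rational_approx (hℓ : ∀ e, 0 < ℓ e) :
    ∃ ε : ℝ, 0 < ε ∧ (∀ e, ε < ℓ e) ∧ ∃ L : ℕ → LengthBox ℓ ε,
      Tendsto (fun n => (L n).1) atTop (𝓝 ℓ) ∧ ∀ n e, ∃ q : ℚ, (L n).1 e = q := by
  obtain ⟨ε, hε, hεℓ⟩ : ∃ ε : ℝ, 0 < ε ∧ ∀ e, ε < ℓ e := by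
    cases isEmpty_or_nonempty E
    · exact ⟨1, one_pos, fun e => isEmptyElim e⟩
    · obtain ⟨e₀, h⟩ := Finite.exists_min ℓ
      exact ⟨ℓ e₀ / 2, half_pos (hℓ e₀), fun e => by linarith [h e, hℓ e₀]⟩
  -- The gap `ε / (n + 1)` keeps the approximants in the box and makes them converge.
  have hq : ∀ (n : ℕ) (e : E), ∃ q : ℚ, ℓ e - ε / (n + 1) < q ∧ (q : ℝ) < ℓ e := fun n e =>
    exists_rat_btwn (by have : 0 < ε / (n + 1) := by positivity
                        linarith)
  choose q hq1 hq2 using hq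
  have hle : ∀ n : ℕ, ε / (n + 1) ≤ ε := fun n => div_le_self hε.le (by simp)
  refine ⟨ε, hε, hεℓ, fun n => ⟨fun e => q n e, fun e => abs_le.2 ?_⟩, ?_, fun n e => ⟨q n e, rfl⟩⟩
  · constructor <;> linarith [hq1 n e, hq2 n e, hle n]
  · refine tendsto_pi_nhds.2 fun e => ?_
    have h0 : Tendsto (fun n : ℕ => ℓ e - ε / ((n : ℝ) + 1)) atTop (𝓝 (ℓ e)) := by
      have := (tendsto_one_div_add_atTop_nhds_zero_nat (𝕜 := ℝ)).const_mul ε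
      simpa [div_eq_mul_inv] using this.const_sub (ℓ e)
    exact tendsto_of_tendsto_of_tendsto_of_le_of_le h0 tendsto_const_nhds
      (fun n => (hq1 n e).le) (fun n => (hq2 n e).le)

end Semicontinuity

end FinGraph

theorem mainTheorem5 :
    -- semicontinuity of the rank, and closedness of the condition of having a linear system
    (∀ (V : Type u) (E : Type v) [Fintype V] [Fintype E] (G : FinGraph V E) (ℓ : E → ℝ) (ε : ℝ)
        (_hε : 0 < ε) (_hℓ : ∀ e, ε < ℓ e),
      (∀ d : ℕ,
        CompactSpace (G.DivisorSpace ℓ ε d) ∧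
        UpperSemicontinuous (fun x : G.DivisorSpace ℓ ε d => FinGraph.rank x.div) ∧
        ∀ i : ℤ, IsClosed {x : G.DivisorSpace ℓ ε d | i ≤ FinGraph.rank x.div}) ∧
      (∀ r d : ℤ,
        IsClosed {ℓ' : FinGraph.LengthBox ℓ ε | G.HasLinearSystem ℓ'.1 r d} ∧
        ∀ L : ℕ → FinGraph.LengthBox ℓ ε,
          Filter.Tendsto (fun n => (L n).1) Filter.atTop (nhds ℓ) →
          (∀ n, G.HasLinearSystem (L n).1 r d) → G.HasLinearSystem ℓ r d)) ∧
    -- passage from graphs with rational edge lengths to all metric graphs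
    (∀ g r d : ℤ,
      (∀ (V : Type u) (E : Type v) [Fintype V] [Fintype E] (G : FinGraph V E) (ℓ : E → ℝ),
        (∀ e, 0 < ℓ e ∧ ∃ q : ℚ, ℓ e = q) → G.genus = g → G.HasLinearSystem ℓ r d) →
      ∀ (V : Type u) (E : Type v) [Fintype V] [Fintype E] (G : FinGraph V E) (ℓ : E → ℝ),
        (∀ e, 0 < ℓ e) → G.genus = g → G.HasLinearSystem ℓ r d) := by
  refine ⟨fun V E _ _ G ℓ ε hε hℓ => ⟨fun d => ⟨FinGraph.compactSpace_divisorSpace hℓ d, ?_,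
    FinGraph.isClosed_le_rank hℓ d⟩, fun r d => ⟨FinGraph.isClosed_hasLinearSystem hℓ r d,
    fun L hL h => FinGraph.hasLinearSystem_of_tendsto hε hℓ hL h⟩⟩, ?_⟩
  · exact upperSemicontinuous_iff_isClosed_preimage.2 (FinGraph.isClosed_le_rank hℓ d)
  · intro g r d hQ V E _ _ G ℓ hℓ hg
    obtain ⟨ε, hε, hεℓ, L, hL, hq⟩ := FinGraph.exists_rational_approx hℓ
    -- The approximants share the graph `G`, so `hg` applies to them unchanged.
    exact FinGraph.hasLinearSystem_of_tendsto hε hεℓ hL fun n =>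
      hQ V E G _ (fun e => ⟨FinGraph.LengthBox.pos hεℓ _ e, hq n e⟩) hg
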